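/- Let $M$ be a closed (compact, Hausdorff, without boundary) smooth manifold of dimension $d$, and let $G$ be a subgroup of the group $\mathrm{Diff}(M)$ of $C^\infty$ diffeomorphisms of $M$, generated by a finite set $S$. For $g\in G$ let $|g|_S$ be the minimal length of a word in $S\cup S^{-1}$ equal to $g$, and let $B_n=\{g\in G: |g|_S\le n\}$. Fix a finite covering of $M$ by compact sets $K_i$, each contained in the domain of a smooth coordinate chart $\psi_i$. For a function $f$ that is $C^r$ near $x$, let $\|f\|_{r,x}=\max\|D^k(f\circ\psi_i^{-1})(\psi_i(x))\|$, the maximum being over $0\le k\le r$ and all $i$ with $x\in K_i$; this is a norm on the $r$-jets at $x$. For $\phi\in\mathrm{Diff}(M)$ let $\|\phi\|_r=\sup_{x\in M}\sup\{\|f\circ\phi\|_{r,x}: \|f\|_{r,\phi(x)}\le 1\}$. For a field $T$ of bilinear forms on the tangent spaces let $\|T\|_r=\max\|D^k((\psi_i^{-1})^*T)(\psi_i(x))\|$, the maximum being over all $i$, all $x\in K_i$ and $0\le k\le r$. Suppose that $G$ has sub-exponential growth, i.e. $\lim_{n\to\infty}\frac{\log |B_n|}{n}=0$, and sub-exponential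 growth of derivatives, i.e. for all $\epsilon>0$ and all integers $r>0$ there is $N_{\epsilon,r}$ such that $\|w_n\|_r\le e^{\epsilon n}$ for all $n\ge N_{\epsilon,r}$ and every product $w_n$ of $n$ elements of $S\cup S^{-1}$. Then for every $\epsilon>0$ there is a $C^\infty$ Riemannian metric $m^\epsilon$ on $M$ such that, with $\|v\|^\epsilon_x=\sqrt{m^\epsilon_x(v,v)}$, $$e^{-\epsilon}\|v\|^\epsilon_x\le\|D_xs(v)\|^\epsilon_{s(x)}\le e^{\epsilon}\|v\|^\epsilon_x\qquad\text{for all } s\in S,\ x\in M,\ v\in T_xM.$$ Moreover, for every $C^\infty$ Riemannian metric $m$ on $M$ and every $\epsilon>0$ there is such a metric $m^\epsilon$ that is the limit of the finite sums $m^\epsilon_n=\sum_{g\in B_n}e^{-\epsilon|g|_S}g^*m$, in the sense that $\|m^\epsilon_n-m^\epsilon\|_r\to0$ as $n\to\infty$ for every $r\ge0$, where $(g^*m)_x(u,v)=m_{g(x)}(D_xg(u),D_xg(v))$. -/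

import Mathlib

open scoped Manifold ContDiff Topology

noncomputable section

/-! ### Word length and growth in a group -/

/-- `l` is a word in the letters `S ∪ S⁻¹`. -/
def IsWord {Γ : Type*} [Group Γ] (S : Set Γ) (l : List Γ) : Prop :=
  ∀ a ∈ l, a ∈ S ∨ a⁻¹ ∈ S

/-- The word length `|g|_S`: the minimal length of a word in `S ∪ S⁻¹` equal to `g`.
It is meaningful for `g` in the subgroup generated by `S`. -/
def wordLength {Γ : Type*} [Group Γ] (S : Set Γ) (g : Γ) : ℕ :=
  sInf {n : ℕ | ∃ l : List Γ, IsWord S l ∧ l.length = n ∧ l.prod = g}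

/-- The ball `B_n`: the elements of the group `G` of word length at most `n`. -/
def wordBall {Γ : Type*} [Group Γ] (G : Subgroup Γ) (S : Set Γ) (n : ℕ) : Set Γ :=
  {g | g ∈ G ∧ wordLength S g ≤ n}

/-- Sub-exponential growth of the group `G`, generated by the finite set `S`:
`log |B_n| / n → 0`. -/
def SubexpGrowth {Γ : Type*} [Group Γ] (G : Subgroup Γ) (S : Set Γ) : Prop :=
  Filter.Tendsto (fun n : ℕ => Real.log ((wordBall G S n).ncard : ℝ) / (n : ℝ))
    Filter.atTop (𝓝 0)

section Manifold

variable (d : ℕ) (M : Type*) [TopologicalSpace M] [ChartedSpace (EuclideanSpace ℝ (Fin d)) M]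

/-- The smooth diffeomorphisms of `M`. -/
abbrev Diff : Type _ := Diffeomorph (𝓡 d) (𝓡 d) M M ∞

variable {d M}

/-- `Diff M` is a group under composition, `(f * g) x = f (g x)`. -/
instance instGroupDiff : Group (Diff d M) where
  mul f g := g.trans f
  one := Diffeomorph.refl (𝓡 d) M ∞
  inv f := f.symm
  mul_assoc _ _ _ := rfl
  one_mul _ := rfl
  mul_one _ := rfl
  inv_mul_cancel f := f.self_trans_symm

variable (d M)

/-- A finite covering of `M` by compact sets `K i`, each contained in the domain of a smooth
coordinate chart `e i`. -/
structure ChartCover where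
  /-- the number of charts -/
  card : ℕ
  /-- the charts -/
  e : Fin card → OpenPartialHomeomorph M (EuclideanSpace ℝ (Fin d))
  /-- the compact pieces -/
  K : Fin card → Set M
  mem_maximalAtlas : ∀ i, e i ∈ IsManifold.maximalAtlas (𝓡 d) ∞ M
  isCompact : ∀ i, IsCompact (K i)
  subset_source : ∀ i, K i ⊆ (e i).source
  cover : ∀ x, ∃ i, x ∈ K i

variable {d M}

/-- The norm of the `r`-jet at `x` of a real function `s` on `M`: the largest norm of a derivative
of order at most `r` of `s` at `x`, in those charts of the covering whose piece contains `x`. -/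
def ChartCover.jetNorm (A : ChartCover d M) (r : ℕ) (s : M → ℝ) (x : M) : ENNReal :=
  ⨆ (i : Fin A.card) (_ : x ∈ A.K i) (k : ℕ) (_ : k ≤ r),
    ‖iteratedFDeriv ℝ k (fun y => s ((A.e i).symm y)) (A.e i x)‖ₑ

/-- The `C^r` norm `‖φ‖_r` of a diffeomorphism: the maximum over `x` of the operator norm of the
linear map `j^r(φ)(x)` from `r`-jets of functions at `φ x` to `r`-jets of functions at `x` that is
induced by `s ↦ s ∘ φ`. -/
def ChartCover.crNorm (A : ChartCover d M) (r : ℕ) (φ : Diff d M) : ENNReal :=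
  ⨆ (x : M) (s : M → ℝ) (_ : ContMDiffAt (𝓡 d) 𝓘(ℝ, ℝ) (r : ℕ∞) s (φ x))
    (_ : A.jetNorm r s (φ x) ≤ 1), A.jetNorm r (fun z => s (φ z)) x

/-- Sub-exponential growth of derivatives of the group generated by `S`: for every `ε > 0` and every
`r > 0`, all products `w` of `n` elements of `S ∪ S⁻¹` satisfy `‖w‖_r ≤ e^{εn}`, once `n` is
large. -/
def SubexpGrowthOfDerivatives (A : ChartCover d M) (S : Set (Diff d M)) : Prop :=
  ∀ ε : ℝ, 0 < ε → ∀ r : ℕ, 0 < r → ∃ N : ℕ, ∀ n : ℕ, N ≤ n →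
    ∀ l : List (Diff d M), IsWord S l → l.length = n →
      A.crNorm r l.prod ≤ ENNReal.ofReal (Real.exp (ε * n))

variable (d M)

/-- Smooth Riemannian metrics on `M`. -/
abbrev SmoothMetric [IsManifold (𝓡 d) ∞ M] : Type _ :=
  Bundle.ContMDiffRiemannianMetric (𝓡 d) ∞ (EuclideanSpace ℝ (Fin d))
    (fun x : M => TangentSpace (𝓡 d) x)

/-- Fields of bilinear forms on the tangent spaces of `M`. -/
abbrev BilinField : Type _ :=
  ∀ x : M, TangentSpace (𝓡 d) x →L[ℝ] TangentSpace (𝓡 d) x →L[ℝ] ℝ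

variable {d M}

/-- The pullback `(f^*T)_x(u, v) = T_{f x}(D_x f u, D_x f v)`. -/
def pullback (f : Diff d M) (T : BilinField d M) : BilinField d M := fun x =>
  (ContinuousLinearMap.precomp ℝ (mfderiv (𝓡 d) (𝓡 d) f x)).comp
    ((T (f x)).comp (mfderiv (𝓡 d) (𝓡 d) f x))

/-- The expression of `T` in the chart `e`, that is `(e⁻¹)^*T`, with values in the bilinear forms
on `ℝ^d`. -/
def inChart (e : OpenPartialHomeomorph M (EuclideanSpace ℝ (Fin d))) (T : BilinField d M)
    (y : EuclideanSpace ℝ (Fin d)) :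
    EuclideanSpace ℝ (Fin d) →L[ℝ] EuclideanSpace ℝ (Fin d) →L[ℝ] ℝ :=
  (ContinuousLinearMap.precomp ℝ (mfderiv (𝓡 d) (𝓡 d) e.symm y)).comp
    ((T (e.symm y)).comp (mfderiv (𝓡 d) (𝓡 d) e.symm y))

/-- The `C^r` norm of a field of bilinear forms, in the charts of the covering. -/
def ChartCover.tensorNorm (A : ChartCover d M) (r : ℕ) (T : BilinField d M) : ENNReal :=
  ⨆ (i : Fin A.card) (x : M) (_ : x ∈ A.K i) (k : ℕ) (_ : k ≤ r),
    ‖iteratedFDeriv ℝ k (inChart (A.e i) T) (A.e i x)‖ₑ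

/-- The finite sum `∑_{g ∈ B_n} e^{-ε|g|_S} g^*m`. -/
def averagedForm (G : Subgroup (Diff d M)) (S : Set (Diff d M)) (ε : ℝ) (T : BilinField d M)
    (n : ℕ) : BilinField d M :=
  fun x => ∑ᶠ g ∈ wordBall G S n, Real.exp (-ε * wordLength S g) • pullback g T x

/-- The length `√(m_x(v, v))` of a tangent vector. -/
def tangentNorm [IsManifold (𝓡 d) ∞ M] (m : SmoothMetric d M) (x : M)
    (v : TangentSpace (𝓡 d) x) : ℝ :=
  Real.sqrt (m.inner x v v)

/-- `s` distorts the lengths of tangent vectors by at most the factor `e^ε` either way. -/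
def BilipschitzOnTangent [IsManifold (𝓡 d) ∞ M] (m : SmoothMetric d M) (ε : ℝ)
    (s : Diff d M) : Prop :=
  ∀ (x : M) (v : TangentSpace (𝓡 d) x),
    Real.exp (-ε) * tangentNorm m x v ≤ tangentNorm m (s x) (mfderiv (𝓡 d) (𝓡 d) s x v) ∧
    tangentNorm m (s x) (mfderiv (𝓡 d) (𝓡 d) s x v) ≤ Real.exp ε * tangentNorm m x v

end Manifold

end

/-!
Fix a Riemannian metric `m` and put `m^ε = ∑_{g ∈ G} e^{-ε|g|} g^*m`. A generator `s` permutes the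
terms of this series, `s^*(g^*m) = (gs)^*m`, and the word lengths of `g` and `gs` differ by at most
one, so `e^{-ε} m^ε ≤ s^*m^ε ≤ e^ε m^ε` (`sumField_quasi_invariant`). Taking square roots gives the
factor `e^{ε/2}`, hence `e^ε`, for lengths. The form `m^ε` is positive definite because the term
`g = 1` is `m` and the other terms are nonnegative. So everything rests on the convergence of the
series together with all derivatives.

In charts, `g^*m` is the pullback of a smooth field by the chart expression `F` of `g`. Its
derivatives of order at most `r` at a point are bounded by a constant times `D^{r+2}`, where `D ≥ 1`
bounds the derivatives of `F` of order at most `r + 1` (`norm_iteratedFDeriv_formPullback_le`). The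
norm `‖g‖_{r+1}` is defined by the action of `g` on jets of functions; applied to rescaled coordinate
functions it bounds `D` (`ChartCover.exists_norm_iteratedFDeriv_chartMap_le`). Hence sub-exponential
growth of derivatives gives `‖g^*m‖_r ≤ C e^{ε|g|/2}` for all `g ∈ G`
(`ChartCover.exists_bound_pullback`), and sub-exponential growth of `G` makes `∑ e^{-ε|g|/2}`
converge (`summable_exp_neg_mul_wordLength`).

The pieces `K i` of the covering need not have interior, so bounds on them alone do not allow
termwise differentiation in a chart. But every point of `M` lies in some piece, and a change of
charts turns the bounds on the pieces into locally uniform bounds in an arbitrary chart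
(`ChartCover.exists_bound_chart_change`). This gives the smoothness of the sum
(`ChartCover.isSmooth_sumField`) and, applied to the tails of the series, convergence in all `C^r`
norms (`ChartCover.tensorNorm_sumField_le`, `tendsto_tensorNorm_averagedForm_sub`).
-/

noncomputable section

set_option maxSynthPendingDepth 3

/-! ### Derivatives of products, pullbacks and series on normed spaces -/

section Analysis

variable {E F F' H : Type*} [NormedAddCommGroup E] [NormedSpace ℝ E]
  [NormedAddCommGroup F] [NormedSpace ℝ F] [NormedAddCommGroup F'] [NormedSpace ℝ F']
  [NormedAddCommGroup H] [NormedSpace ℝ H]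

theorem ContDiffOn.exists_bound_iteratedFDeriv {f : E → F} {U K : Set E}
    (hf : ContDiffOn ℝ ∞ f U) (hU : IsOpen U) (hK : IsCompact K) (hKU : K ⊆ U) (r : ℕ) :
    ∃ R : ℝ, 1 ≤ R ∧ ∀ k ≤ r, ∀ y ∈ K, ‖iteratedFDeriv ℝ k f y‖ ≤ R := by
  have hk : ∀ k : ℕ, ∃ R : ℝ, ∀ y ∈ K, ‖iteratedFDeriv ℝ k f y‖ ≤ R := by
    intro k
    have hc : ContinuousOn (fun y => iteratedFDeriv ℝ k f y) K := by
      have h1 := hf.continuousOn_iteratedFDerivWithin (m := k) (by exact_mod_cast le_top)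
        hU.uniqueDiffOn
      exact (h1.congr fun y hy => (iteratedFDerivWithin_of_isOpen k hU hy).symm).mono hKU
    obtain ⟨R, hR⟩ := hK.exists_bound_of_continuousOn hc
    exact ⟨R, hR⟩
  choose R hR using hk
  refine ⟨1 + ∑ k ∈ Finset.range (r + 1), |R k|, ?_, fun k hkr y hy => ?_⟩
  · have : 0 ≤ ∑ k ∈ Finset.range (r + 1), |R k| := Finset.sum_nonneg fun _ _ => abs_nonneg _
    linarith
  · have h1 : |R k| ≤ ∑ k ∈ Finset.range (r + 1), |R k| :=
      Finset.single_le_sum (f := fun k => |R k|) (fun _ _ => abs_nonneg _)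
        (Finset.mem_range.2 (by omega))
    linarith [hR k y hy, le_abs_self (R k)]

theorem ContinuousLinearMap.norm_iteratedFDeriv_bilinear_le_of_forall_le
    (B : F →L[ℝ] F' →L[ℝ] H) (hB : ‖B‖ ≤ 1) {f : E → F} {g : E → F'} {U : Set E} (hU : IsOpen U)
    (hf : ContDiffOn ℝ ∞ f U) (hg : ContDiffOn ℝ ∞ g U) {y : E} (hy : y ∈ U) {r : ℕ} {a b : ℝ}
    (ha : ∀ k ≤ r, ‖iteratedFDeriv ℝ k f y‖ ≤ a) (hb : ∀ k ≤ r, ‖iteratedFDeriv ℝ k g y‖ ≤ b)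
    {k : ℕ} (hk : k ≤ r) :
    ‖iteratedFDeriv ℝ k (fun z => B (f z) (g z)) y‖ ≤ 2 ^ r * (a * b) := by
  have ha0 : 0 ≤ a := (norm_nonneg _).trans (ha 0 (Nat.zero_le _))
  have hb0 : 0 ≤ b := (norm_nonneg _).trans (hb 0 (Nat.zero_le _))
  have h := B.norm_iteratedFDerivWithin_le_of_bilinear_of_le_one hf hg hU.uniqueDiffOn hy (n := k)
    (by exact_mod_cast le_top) hB
  rw [iteratedFDerivWithin_of_isOpen k hU hy] at h
  refine h.trans ?_
  calc _ ≤ ∑ i ∈ Finset.range (k + 1), (k.choose i : ℝ) * (a * b) := by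
        refine Finset.sum_le_sum fun i hi => ?_
        have hi' := Finset.mem_range.1 hi
        rw [iteratedFDerivWithin_of_isOpen _ hU hy, iteratedFDerivWithin_of_isOpen _ hU hy, mul_assoc]
        gcongr
        · exact ha i (by omega)
        · exact hb _ (by omega)
    _ = 2 ^ k * (a * b) := by
        rw [← Finset.sum_mul]
        congr 1
        exact_mod_cast Nat.sum_range_choose k
    _ ≤ 2 ^ r * (a * b) := by
        gcongr
        norm_num

/-- The pullback `(u, v) ↦ β (A u) (A v)` of bilinear forms `β` along a linear map `A`, as a
continuous linear map in `β`. -/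
def bilinPull (A : E →L[ℝ] F) : (F →L[ℝ] F →L[ℝ] ℝ) →L[ℝ] (E →L[ℝ] E →L[ℝ] ℝ) :=
  ((ContinuousLinearMap.compL ℝ E (F →L[ℝ] ℝ) (E →L[ℝ] ℝ)) (ContinuousLinearMap.precomp ℝ A)).comp
    ((ContinuousLinearMap.compL ℝ E F (F →L[ℝ] ℝ)).flip A)

theorem bilinPull_apply (A : E →L[ℝ] F) (β : F →L[ℝ] F →L[ℝ] ℝ) (u v : E) :
    bilinPull A β u v = β (A u) (A v) := rfl

theorem bilinPull_comp (A : E →L[ℝ] F) (A' : F →L[ℝ] F') (β : F' →L[ℝ] F' →L[ℝ] ℝ) :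
    bilinPull (A'.comp A) β = bilinPull A (bilinPull A' β) := rfl

theorem bilinPull_id (β : E →L[ℝ] E →L[ℝ] ℝ) :
    bilinPull (ContinuousLinearMap.id ℝ E) β = β := rfl

/-- The pullback `f^*h` of a field `h` of bilinear forms along a map `f` between vector spaces. -/
def formPullback (f : E → F) (h : F → F →L[ℝ] F →L[ℝ] ℝ) (y : E) : E →L[ℝ] E →L[ℝ] ℝ :=
  bilinPull (fderiv ℝ f y) (h (f y))

theorem norm_iteratedFDeriv_clm_comp_le {G₁ G₂ G₃ : Type*} [NormedAddCommGroup G₁]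
    [NormedSpace ℝ G₁] [NormedAddCommGroup G₂] [NormedSpace ℝ G₂] [NormedAddCommGroup G₃]
    [NormedSpace ℝ G₃] {p : E → G₂ →L[ℝ] G₃} {q : E → G₁ →L[ℝ] G₂} {U : Set E} (hU : IsOpen U)
    (hp : ContDiffOn ℝ ∞ p U) (hq : ContDiffOn ℝ ∞ q U) {y : E} (hy : y ∈ U) {r : ℕ} {a b : ℝ}
    (ha : ∀ k ≤ r, ‖iteratedFDeriv ℝ k p y‖ ≤ a) (hb : ∀ k ≤ r, ‖iteratedFDeriv ℝ k q y‖ ≤ b) :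
    ∀ k ≤ r, ‖iteratedFDeriv ℝ k (fun z => (p z).comp (q z)) y‖ ≤ 2 ^ r * (a * b) := fun _ hk =>
  (ContinuousLinearMap.compL ℝ G₁ G₂ G₃).norm_iteratedFDeriv_bilinear_le_of_forall_le
    (ContinuousLinearMap.norm_compL_le ..) hU hp hq hy ha hb hk

/-- Precomposition with a linear map `A`, as a continuous linear map in `A`. -/
def precompL (E F : Type*) [NormedAddCommGroup E] [NormedSpace ℝ E] [NormedAddCommGroup F]
    [NormedSpace ℝ F] : (E →L[ℝ] F) →L[ℝ] (F →L[ℝ] ℝ) →L[ℝ] (E →L[ℝ] ℝ) :=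
  (ContinuousLinearMap.compL ℝ E F ℝ).flip

theorem norm_precompL_le : ‖precompL E F‖ ≤ 1 := by
  rw [precompL, ContinuousLinearMap.opNorm_flip]
  exact ContinuousLinearMap.norm_compL_le ..

/-- The pullback in terms of the linear operations `L ↦ L ∘ A` and `A ↦ (L ↦ L ∘ A)`, to which bounds
for derivatives of products apply. -/
theorem formPullback_eq (f : E → F) (h : F → F →L[ℝ] F →L[ℝ] ℝ) :
    formPullback f h =
      fun y => (precompL E F (fderiv ℝ f y)).comp ((h (f y)).comp (fderiv ℝ f y)) := rfl

theorem ContDiffOn.formPullback {f : E → F} {h : F → F →L[ℝ] F →L[ℝ] ℝ} {U : Set E} {V : Set F}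
    (hU : IsOpen U) (hf : ContDiffOn ℝ ∞ f U) (hh : ContDiffOn ℝ ∞ h V) (hUV : Set.MapsTo f U V) :
    ContDiffOn ℝ ∞ (formPullback f h) U := by
  have h1 : ContDiffOn ℝ ∞ (fderiv ℝ f) U := hf.fderiv_of_isOpen hU (by simp)
  have h2 : ContDiffOn ℝ ∞ (fun z => h (f z)) U := hh.comp hf hUV
  rw [formPullback_eq]
  exact (h1.continuousLinearMap_comp (precompL E F)).clm_comp (h2.clm_comp h1)

/-- The derivatives of order at most `r` of a pullback `f^*h` are linear in those of `h` and
polynomial in those of `f` of order at most `r + 1`. -/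
theorem norm_iteratedFDeriv_formPullback_le {f : E → F} {h : F → F →L[ℝ] F →L[ℝ] ℝ} {U : Set E}
    {V : Set F} (hU : IsOpen U) (hV : IsOpen V) (hf : ContDiffOn ℝ ∞ f U)
    (hh : ContDiffOn ℝ ∞ h V) (hUV : Set.MapsTo f U V) {y : E} (hy : y ∈ U) {r : ℕ} {C D : ℝ}
    (hD1 : 1 ≤ D) (hD : ∀ k ≤ r + 1, ‖iteratedFDeriv ℝ k f y‖ ≤ D)
    (hC : ∀ k ≤ r, ‖iteratedFDeriv ℝ k h (f y)‖ ≤ C) {k : ℕ} (hk : k ≤ r) :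
    ‖iteratedFDeriv ℝ k (formPullback f h) y‖ ≤ 4 ^ r * r.factorial * C * D ^ (r + 2) := by
  have hC0 : 0 ≤ C := (norm_nonneg _).trans (hC 0 (Nat.zero_le _))
  have h1 : ContDiffOn ℝ ∞ (fderiv ℝ f) U := hf.fderiv_of_isOpen hU (by simp)
  have h2 : ContDiffOn ℝ ∞ (fun z => h (f z)) U := hh.comp hf hUV
  have b1 : ∀ k ≤ r, ‖iteratedFDeriv ℝ k (fderiv ℝ f) y‖ ≤ D := fun k hk => by
    rw [norm_iteratedFDeriv_fderiv]
    exact hD _ (by omega)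
  have b2 : ∀ k ≤ r, ‖iteratedFDeriv ℝ k (fun z => h (f z)) y‖ ≤ r.factorial * C * D ^ r := by
    intro k hk
    have := norm_iteratedFDerivWithin_comp_le hh hf (n := k) (by exact_mod_cast le_top)
      hV.uniqueDiffOn hU.uniqueDiffOn hUV hy (C := C) (D := D)
      (fun i hi => by
        rw [iteratedFDerivWithin_of_isOpen _ hV (hUV hy)]
        exact hC i (hi.trans hk))
      (fun i hi1 hi => by
        rw [iteratedFDerivWithin_of_isOpen _ hU hy]
        exact (hD i (by omega)).trans (le_self_pow₀ hD1 (by omega)))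
    rw [iteratedFDerivWithin_of_isOpen _ hU hy] at this
    refine this.trans ?_
    gcongr
  have h4 := h1.continuousLinearMap_comp (precompL E F)
  have b4 : ∀ k ≤ r, ‖iteratedFDeriv ℝ k (fun z => precompL E F (fderiv ℝ f z)) y‖ ≤ D := by
    intro k hk
    refine ((precompL E F).norm_iteratedFDeriv_comp_left (h1.contDiffAt (hU.mem_nhds hy))
      (by exact_mod_cast le_top)).trans ?_
    exact (mul_le_of_le_one_left (norm_nonneg _) norm_precompL_le).trans (b1 k hk)
  rw [formPullback_eq]
  refine (norm_iteratedFDeriv_clm_comp_le hU h4 (h2.clm_comp h1) hy b4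
    (norm_iteratedFDeriv_clm_comp_le hU h2 h1 hy b2 b1) k hk).trans (le_of_eq ?_)
  rw [show (4 : ℝ) = 2 * 2 by norm_num, mul_pow]
  ring

/-- Termwise differentiation of a series of smooth functions all of whose derivatives are dominated
by summable series on a connected open set. -/
theorem hasFTaylorSeriesUpToOn_tsum [CompleteSpace F] {ι : Type*} {f : ι → E → F} {U : Set E}
    (hU : IsOpen U) (hU' : IsPreconnected U) (hf : ∀ a, ContDiffOn ℝ ∞ (f a) U)
    {u : ℕ → ι → ℝ} (hu : ∀ k, Summable (u k))
    (hfu : ∀ k a, ∀ y ∈ U, ‖iteratedFDeriv ℝ k (f a) y‖ ≤ u k a) :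
    HasFTaylorSeriesUpToOn ∞ (fun y => ∑' a, f a y)
      (fun y k => ∑' a, iteratedFDeriv ℝ k (f a) y) U := by
  have hsum : ∀ k, ∀ y ∈ U, Summable fun a => iteratedFDeriv ℝ k (f a) y := fun k y hy =>
    Summable.of_norm_bounded (hu k) fun a => hfu k a y hy
  have hft : ∀ a, HasFTaylorSeriesUpToOn ∞ (f a) (ftaylorSeriesWithin ℝ (f a) U) U := fun a =>
    (hf a).ftaylorSeriesWithin hU.uniqueDiffOn
  have hder : ∀ k a, ∀ y ∈ U, HasFDerivAt (iteratedFDeriv ℝ k (f a))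
      (iteratedFDeriv ℝ (k + 1) (f a) y).curryLeft y := by
    intro k a y hy
    have h1 := ((hft a).fderivWithin k (by exact_mod_cast WithTop.coe_lt_top _) y hy).hasFDerivAt
      (hU.mem_nhds hy)
    simp only [ftaylorSeriesWithin] at h1
    rw [iteratedFDerivWithin_of_isOpen _ hU hy] at h1
    exact h1.congr_of_eventuallyEq (Filter.eventuallyEq_of_mem (hU.mem_nhds hy) fun z hz =>
      (iteratedFDerivWithin_of_isOpen _ hU hz).symm)
  refine ⟨fun y hy => ?_, fun k _ y hy => ?_, fun k _ => ?_⟩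
  · have := (continuousMultilinearCurryFin0 ℝ E F).toContinuousLinearEquiv.map_tsum
      (f := fun a => iteratedFDeriv ℝ 0 (f a) y) (L := .unconditional ι)
    exact this.trans (tsum_congr fun a => rfl)
  · have hu' : ∀ a, ∀ z ∈ U, ‖(iteratedFDeriv ℝ (k + 1) (f a) z).curryLeft‖ ≤ u (k + 1) a :=
      fun a z hz => by
        rw [ContinuousMultilinearMap.curryLeft_norm]
        exact hfu (k + 1) a z hz
    have h := hasFDerivAt_tsum_of_isPreconnected (hu (k + 1)) hU hU' (fun a z hz => hder k a z hz)
      hu' hy (hsum k y hy) hy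
    have h2 : ∑' a, (iteratedFDeriv ℝ (k + 1) (f a) y).curryLeft
        = (∑' a, iteratedFDeriv ℝ (k + 1) (f a) y).curryLeft :=
      ((continuousMultilinearCurryLeftEquiv ℝ (fun _ : Fin (k + 1) => E)
        F).toContinuousLinearEquiv.map_tsum (f := fun a => iteratedFDeriv ℝ (k + 1) (f a) y)
          (L := .unconditional ι)).symm
    rw [h2] at h
    exact h.hasFDerivWithinAt
  · exact continuousOn_tsum
      (fun a y hy => (hder k a y hy).continuousAt.continuousWithinAt) (hu k)
      (fun a y hy => hfu k a y hy)

theorem contDiffOn_tsum_of_isPreconnected [CompleteSpace F] {ι : Type*} {f : ι → E → F} {U : Set E}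
    (hU : IsOpen U) (hU' : IsPreconnected U) (hf : ∀ a, ContDiffOn ℝ ∞ (f a) U)
    {u : ℕ → ι → ℝ} (hu : ∀ k, Summable (u k))
    (hfu : ∀ k a, ∀ y ∈ U, ‖iteratedFDeriv ℝ k (f a) y‖ ≤ u k a) :
    ContDiffOn ℝ ∞ (fun y => ∑' a, f a y) U :=
  fun _ hy => (hasFTaylorSeriesUpToOn_tsum hU hU' hf hu hfu).contDiffOn _ hy

theorem iteratedFDeriv_tsum_of_isPreconnected [CompleteSpace F] {ι : Type*} {f : ι → E → F}
    {U : Set E}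
    (hU : IsOpen U) (hU' : IsPreconnected U) (hf : ∀ a, ContDiffOn ℝ ∞ (f a) U)
    {u : ℕ → ι → ℝ} (hu : ∀ k, Summable (u k))
    (hfu : ∀ k a, ∀ y ∈ U, ‖iteratedFDeriv ℝ k (f a) y‖ ≤ u k a) (k : ℕ) {y : E} (hy : y ∈ U) :
    iteratedFDeriv ℝ k (fun z => ∑' a, f a z) y = ∑' a, iteratedFDeriv ℝ k (f a) y := by
  rw [← iteratedFDerivWithin_of_isOpen k hU hy]
  exact ((hasFTaylorSeriesUpToOn_tsum hU hU' hf hu hfu).eq_iteratedFDerivWithin_of_uniqueDiffOn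
    (m := k) (by exact_mod_cast le_top) hU.uniqueDiffOn hy).symm

/-- A positive definite bilinear form on a finite-dimensional space is coercive. -/
theorem exists_pos_mul_norm_sq_le [FiniteDimensional ℝ E] (β : E →L[ℝ] E →L[ℝ] ℝ)
    (hβ : ∀ v, v ≠ 0 → 0 < β v v) : ∃ c : ℝ, 0 < c ∧ ∀ v, c * ‖v‖ ^ 2 ≤ β v v := by
  rcases (Metric.sphere (0 : E) 1).eq_empty_or_nonempty with he | hne
  · refine ⟨1, one_pos, fun v => ?_⟩
    have hv : v = 0 := by
      by_contra hv
      have : (‖v‖⁻¹ • v) ∈ Metric.sphere (0 : E) 1 := by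
        simp [norm_smul, hv]
      simp [he] at this
    simp [hv]
  · obtain ⟨w, hw, hmin⟩ := (isCompact_sphere (0 : E) 1).exists_isMinOn hne
      (f := fun v => β v v) (by fun_prop)
    have hw0 : w ≠ 0 := by
      rintro rfl
      simp at hw
    refine ⟨β w w, hβ w hw0, fun v => ?_⟩
    rcases eq_or_ne v 0 with rfl | hv
    · simp
    have h1 : (‖v‖⁻¹ • v) ∈ Metric.sphere (0 : E) 1 := by
      simp [norm_smul, hv]
    have h2 : β w w ≤ β (‖v‖⁻¹ • v) (‖v‖⁻¹ • v) := hmin h1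
    have hv' : 0 < ‖v‖ := norm_pos_iff.2 hv
    simp only [map_smul, smul_apply, smul_eq_mul] at h2
    calc β w w * ‖v‖ ^ 2 ≤ (‖v‖⁻¹ * (‖v‖⁻¹ * β v v)) * ‖v‖ ^ 2 := by gcongr
      _ = β v v := by field_simp

end Analysis

/-! ### Fields of bilinear forms in charts -/

section Charts

variable {d : ℕ} {M : Type*} [TopologicalSpace M] [ChartedSpace (EuclideanSpace ℝ (Fin d)) M]

/-- The value of a field of bilinear forms at a point, as a bilinear form on the model space. This
uses that the tangent spaces are by definition copies of the model space. -/
def BilinField.form (T : BilinField d M) (x : M) :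
    EuclideanSpace ℝ (Fin d) →L[ℝ] EuclideanSpace ℝ (Fin d) →L[ℝ] ℝ := T x

/-- The derivative of a map between manifolds, as a linear endomorphism of the model space. This
uses that the tangent spaces are by definition copies of the model space. -/
def modelDeriv (d : ℕ) {N N' : Type*} [TopologicalSpace N] [ChartedSpace (EuclideanSpace ℝ (Fin d)) N]
    [TopologicalSpace N'] [ChartedSpace (EuclideanSpace ℝ (Fin d)) N'] (f : N → N') (x : N) :
    EuclideanSpace ℝ (Fin d) →L[ℝ] EuclideanSpace ℝ (Fin d) := mfderiv (𝓡 d) (𝓡 d) f x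

theorem modelDeriv_comp {N N' N'' : Type*} [TopologicalSpace N]
    [ChartedSpace (EuclideanSpace ℝ (Fin d)) N]
    [TopologicalSpace N'] [ChartedSpace (EuclideanSpace ℝ (Fin d)) N']
    [TopologicalSpace N''] [ChartedSpace (EuclideanSpace ℝ (Fin d)) N''] {f : N → N'} {f' : N' → N''}
    {x : N} (hf' : MDifferentiableAt (𝓡 d) (𝓡 d) f' (f x))
    (hf : MDifferentiableAt (𝓡 d) (𝓡 d) f x) :
    modelDeriv d (f' ∘ f) x = (modelDeriv d f' (f x)).comp (modelDeriv d f x) :=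
  mfderiv_comp x hf' hf

theorem modelDeriv_id {N : Type*} [TopologicalSpace N]
    [ChartedSpace (EuclideanSpace ℝ (Fin d)) N] (x : N) :
    modelDeriv d (id : N → N) x = ContinuousLinearMap.id ℝ _ :=
  mfderiv_id

theorem modelDeriv_congr {N N' : Type*} [TopologicalSpace N]
    [ChartedSpace (EuclideanSpace ℝ (Fin d)) N]
    [TopologicalSpace N'] [ChartedSpace (EuclideanSpace ℝ (Fin d)) N'] {f f' : N → N'} {x : N}
    (h : f =ᶠ[𝓝 x] f') : modelDeriv d f x = modelDeriv d f' x :=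
  h.mfderiv_eq

theorem inChart_eq (e : OpenPartialHomeomorph M (EuclideanSpace ℝ (Fin d))) (T : BilinField d M)
    (y : EuclideanSpace ℝ (Fin d)) :
    inChart e T y = bilinPull (modelDeriv d e.symm y) (T.form (e.symm y)) := rfl

theorem pullback_form (g : Diff d M) (T : BilinField d M) (x : M) :
    (pullback g T).form x = bilinPull (modelDeriv d g x) (T.form (g x)) := rfl

theorem pullback_one (T : BilinField d M) : pullback (1 : Diff d M) T = T := by
  funext x
  change (pullback (1 : Diff d M) T).form x = T.form x
  have h : modelDeriv d ((1 : Diff d M) : M → M) x = ContinuousLinearMap.id ℝ _ := modelDeriv_id x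
  rw [pullback_form, h, bilinPull_id]
  rfl

theorem pullback_mul_form (g s : Diff d M) (T : BilinField d M) (x : M) :
    (pullback (g * s) T).form x = bilinPull (modelDeriv d s x) ((pullback g T).form (s x)) := by
  have h : modelDeriv d ((g * s : Diff d M) : M → M) x
      = (modelDeriv d g (s x)).comp (modelDeriv d s x) :=
    modelDeriv_comp (g.contMDiff.mdifferentiable (by simp) _)
      (s.contMDiff.mdifferentiable (by simp) _)
  rw [pullback_form, pullback_form, h, bilinPull_comp]
  rfl

/-- The expression of a diffeomorphism `g` in charts `e` of the source and `e'` of the target. -/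
def chartMap (e e' : OpenPartialHomeomorph M (EuclideanSpace ℝ (Fin d))) (g : Diff d M)
    (y : EuclideanSpace ℝ (Fin d)) : EuclideanSpace ℝ (Fin d) := e' (g (e.symm y))

/-- The open set on which `chartMap e e' g` is an expression of `g` in charts. -/
def chartDomain (e e' : OpenPartialHomeomorph M (EuclideanSpace ℝ (Fin d))) (g : Diff d M) :
    Set (EuclideanSpace ℝ (Fin d)) := e.target ∩ e.symm ⁻¹' (g ⁻¹' e'.source)

variable {e e' : OpenPartialHomeomorph M (EuclideanSpace ℝ (Fin d))}

theorem isOpen_chartDomain (g : Diff d M) : IsOpen (chartDomain e e' g) :=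
  e.symm.continuousOn.isOpen_inter_preimage e.open_target
    (e'.open_source.preimage g.continuous)

theorem mem_chartDomain {g : Diff d M} {x : M} (hx : x ∈ e.source) (hgx : g x ∈ e'.source) :
    e x ∈ chartDomain e e' g :=
  ⟨e.map_source hx, by simpa [e.left_inv hx] using hgx⟩

theorem chartMap_apply {g : Diff d M} {x : M} (hx : x ∈ e.source) :
    chartMap e e' g (e x) = e' (g x) := by
  rw [chartMap, e.left_inv hx]

theorem mapsTo_chartMap (g : Diff d M) :
    Set.MapsTo (chartMap e e' g) (chartDomain e e' g) e'.target :=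
  fun _ hy => e'.map_source hy.2

theorem contDiffOn_chartMap [IsManifold (𝓡 d) ∞ M]
    (he : e ∈ IsManifold.maximalAtlas (𝓡 d) ∞ M) (he' : e' ∈ IsManifold.maximalAtlas (𝓡 d) ∞ M)
    (g : Diff d M) : ContDiffOn ℝ ∞ (chartMap e e' g) (chartDomain e e' g) := by
  have h1 := (contMDiffOn_symm_of_mem_maximalAtlas he).mono
    (show chartDomain e e' g ⊆ e.target from Set.inter_subset_left)
  have h2 := g.contMDiff.comp_contMDiffOn h1
  have h3 := (contMDiffOn_of_mem_maximalAtlas he').comp h2 (fun y hy => hy.2)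
  exact h3.contDiffOn

theorem mdifferentiableAt_of_smooth_chart [IsManifold (𝓡 d) ∞ M]
    (he : e ∈ IsManifold.maximalAtlas (𝓡 d) ∞ M) {x : M} (hx : x ∈ e.source) :
    MDifferentiableAt (𝓡 d) (𝓡 d) e x :=
  ((contMDiffOn_of_mem_maximalAtlas he).contMDiffAt
    (e.open_source.mem_nhds hx)).mdifferentiableAt (by simp)

theorem mdifferentiableAt_symm_of_smooth_chart [IsManifold (𝓡 d) ∞ M]
    (he : e ∈ IsManifold.maximalAtlas (𝓡 d) ∞ M) {y : EuclideanSpace ℝ (Fin d)}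
    (hy : y ∈ e.target) : MDifferentiableAt (𝓡 d) (𝓡 d) e.symm y :=
  ((contMDiffOn_symm_of_mem_maximalAtlas he).contMDiffAt
    (e.open_target.mem_nhds hy)).mdifferentiableAt (by simp)

/-- Pullback along a diffeomorphism, read in charts, is pullback along its chart expression. -/
theorem inChart_pullback_eqOn [IsManifold (𝓡 d) ∞ M]
    (he : e ∈ IsManifold.maximalAtlas (𝓡 d) ∞ M) (he' : e' ∈ IsManifold.maximalAtlas (𝓡 d) ∞ M)
    (g : Diff d M) (T : BilinField d M) :
    Set.EqOn (inChart e (pullback g T)) (formPullback (chartMap e e' g) (inChart e' T))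
      (chartDomain e e' g) := by
  intro y hy
  have hpt : e'.symm (chartMap e e' g y) = g (e.symm y) := e'.left_inv hy.2
  have hsymm := mdifferentiableAt_symm_of_smooth_chart he hy.1
  have hsymm' := mdifferentiableAt_symm_of_smooth_chart he' (mapsTo_chartMap g hy)
  have hF : MDifferentiableAt (𝓡 d) (𝓡 d) (chartMap e e' g) y :=
    (((contDiffOn_chartMap he he' g).contDiffAt
      ((isOpen_chartDomain g).mem_nhds hy)).differentiableAt (by simp)).mdifferentiableAt
  have hg : MDifferentiableAt (𝓡 d) (𝓡 d) g (e.symm y) :=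
    g.contMDiff.mdifferentiable (by simp) _
  have h1 : modelDeriv d (g ∘ e.symm) y = (modelDeriv d g (e.symm y)).comp (modelDeriv d e.symm y) :=
    modelDeriv_comp hg hsymm
  have h2 : modelDeriv d (e'.symm ∘ chartMap e e' g) y
      = (modelDeriv d e'.symm (chartMap e e' g y)).comp (modelDeriv d (chartMap e e' g) y) :=
    modelDeriv_comp hsymm' hF
  have h3 : modelDeriv d (e'.symm ∘ chartMap e e' g) y = modelDeriv d (g ∘ e.symm) y :=
    modelDeriv_congr (Filter.eventuallyEq_of_mem
      ((isOpen_chartDomain g).mem_nhds hy) fun z hz => e'.left_inv hz.2)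
  have h4 : modelDeriv d (chartMap e e' g) y = fderiv ℝ (chartMap e e' g) y := mfderiv_eq_fderiv
  rw [inChart_eq, pullback_form, formPullback, inChart_eq, hpt, ← bilinPull_comp,
    ← bilinPull_comp, ← h1, ← h3, h2, h4]

/-- A field of bilinear forms is smooth if its expressions in all charts of the maximal atlas are
smooth. -/
def BilinField.IsSmooth (T : BilinField d M) : Prop :=
  ∀ e ∈ IsManifold.maximalAtlas (𝓡 d) ∞ M, ContDiffOn ℝ ∞ (inChart e T) e.target

/-- Smoothness of the expression of `g^*T` in a chart near a point follows from smoothness of the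
expression of `T` in some chart near the image point. -/
theorem contDiffOn_inChart_pullback [IsManifold (𝓡 d) ∞ M]
    (he : e ∈ IsManifold.maximalAtlas (𝓡 d) ∞ M) (he' : e' ∈ IsManifold.maximalAtlas (𝓡 d) ∞ M)
    (g : Diff d M) {T : BilinField d M} {V : Set (EuclideanSpace ℝ (Fin d))} (hV : IsOpen V)
    (hT : ContDiffOn ℝ ∞ (inChart e' T) V) :
    ContDiffOn ℝ ∞ (inChart e (pullback g T)) (chartDomain e e' g ∩ chartMap e e' g ⁻¹' V) := by
  have hU : IsOpen (chartDomain e e' g ∩ chartMap e e' g ⁻¹' V) :=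
    (contDiffOn_chartMap he he' g).continuousOn.isOpen_inter_preimage (isOpen_chartDomain g) hV
  exact (ContDiffOn.formPullback hU ((contDiffOn_chartMap he he' g).mono Set.inter_subset_left) hT
    (fun y hy => hy.2)).congr fun y hy => inChart_pullback_eqOn he he' g T hy.1

theorem BilinField.IsSmooth.pullback [IsManifold (𝓡 d) ∞ M] {T : BilinField d M}
    (hT : T.IsSmooth) (g : Diff d M) : BilinField.IsSmooth (pullback g T) := by
  intro e he y hy
  have he' := IsManifold.chart_mem_maximalAtlas (I := 𝓡 d) (n := ∞) (g (e.symm y))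
  have h := contDiffOn_inChart_pullback he he' g (chartAt _ (g (e.symm y))).open_target
    (hT _ he')
  have hU := (contDiffOn_chartMap he he' g).continuousOn.isOpen_inter_preimage
    (isOpen_chartDomain g) (chartAt (EuclideanSpace ℝ (Fin d)) (g (e.symm y))).open_target
  have hmem : y ∈ chartDomain e (chartAt (EuclideanSpace ℝ (Fin d)) (g (e.symm y))) g :=
    ⟨hy, mem_chart_source _ _⟩
  exact (h.contDiffAt (hU.mem_nhds ⟨hmem, mapsTo_chartMap g hmem⟩)).contDiffWithinAt

theorem modelDeriv_symm_comp_modelDeriv [IsManifold (𝓡 d) ∞ M]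
    (he : e ∈ IsManifold.maximalAtlas (𝓡 d) ∞ M) {x : M} (hx : x ∈ e.source) :
    (modelDeriv d e.symm (e x)).comp (modelDeriv d e x) = ContinuousLinearMap.id ℝ _ := by
  rw [← modelDeriv_comp (mdifferentiableAt_symm_of_smooth_chart he (e.map_source hx))
    (mdifferentiableAt_of_smooth_chart he hx), ← modelDeriv_id x]
  exact modelDeriv_congr (Filter.eventuallyEq_of_mem (e.open_source.mem_nhds hx)
    fun z hz => e.left_inv hz)

theorem modelDeriv_comp_modelDeriv_symm [IsManifold (𝓡 d) ∞ M]
    (he : e ∈ IsManifold.maximalAtlas (𝓡 d) ∞ M) {y : EuclideanSpace ℝ (Fin d)}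
    (hy : y ∈ e.target) :
    (modelDeriv d e (e.symm y)).comp (modelDeriv d e.symm y) = ContinuousLinearMap.id ℝ _ := by
  rw [← modelDeriv_comp (mdifferentiableAt_of_smooth_chart he (e.map_target hy))
    (mdifferentiableAt_symm_of_smooth_chart he hy), ← modelDeriv_id y]
  exact modelDeriv_congr (Filter.eventuallyEq_of_mem (e.open_target.mem_nhds hy)
    fun z hz => e.right_inv hz)

/-- The value of a field at a point can be recovered from its expression in a chart. -/
theorem bilinPull_modelDeriv_inChart [IsManifold (𝓡 d) ∞ M]
    (he : e ∈ IsManifold.maximalAtlas (𝓡 d) ∞ M) (T : BilinField d M) {x : M} (hx : x ∈ e.source) :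
    bilinPull (modelDeriv d e x) (inChart e T (e x)) = T.form x := by
  rw [inChart_eq, e.left_inv hx, ← bilinPull_comp, modelDeriv_symm_comp_modelDeriv he hx,
    bilinPull_id]

/-- The expression of a smooth section of the bundle of bilinear forms in a chart is smooth. -/
theorem isSmooth_of_contMDiff [IsManifold (𝓡 d) ∞ M] {T : BilinField d M}
    (hT : ContMDiff (𝓡 d) ((𝓡 d).prod 𝓘(ℝ, EuclideanSpace ℝ (Fin d) →L[ℝ]
      EuclideanSpace ℝ (Fin d) →L[ℝ] ℝ)) ∞
      (fun b => Bundle.TotalSpace.mk' (EuclideanSpace ℝ (Fin d) →L[ℝ]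
      EuclideanSpace ℝ (Fin d) →L[ℝ] ℝ) (E := fun x : M => TangentSpace (𝓡 d) x →L[ℝ]
      TangentSpace (𝓡 d) x →L[ℝ] ℝ) b (T b))) : T.IsSmooth := by
  intro e he
  have hes := contMDiffOn_symm_of_mem_maximalAtlas he
  have htan := hes.contMDiffOn_tangentMapWithin (m := ∞) (by simp) e.open_target.uniqueMDiffOn
  have hvec : ∀ u : EuclideanSpace ℝ (Fin d), ContMDiffOn (𝓡 d) (𝓡 d).tangent ∞
      (fun y => Bundle.TotalSpace.mk' (EuclideanSpace ℝ (Fin d))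
        (E := fun x : M => TangentSpace (𝓡 d) x) (e.symm y)
        (mfderiv (𝓡 d) (𝓡 d) e.symm y u)) e.target := by
    intro u
    have hc : ContMDiffOn (𝓡 d) (𝓡 d).tangent ∞ (fun y : EuclideanSpace ℝ (Fin d) =>
        (⟨y, u⟩ : TangentBundle (𝓡 d) (EuclideanSpace ℝ (Fin d)))) e.target := by
      intro y _
      apply contMDiffWithinAt_vectorSpace_iff_contDiffWithinAt.2
      exact contDiffWithinAt_const
    refine (htan.comp hc fun y hy => hy).congr fun y hy => ?_
    simp only [Function.comp, tangentMapWithin]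
    rw [mfderivWithin_of_isOpen e.open_target hy]
  rw [contDiffOn_clm_apply]
  intro u
  rw [contDiffOn_clm_apply]
  intro v y hy
  have h1 := (hvec u).contMDiffAt (e.open_target.mem_nhds hy)
  have h2 := (hvec v).contMDiffAt (e.open_target.mem_nhds hy)
  have h3 : ContMDiffAt (𝓡 d) ((𝓡 d).prod 𝓘(ℝ, EuclideanSpace ℝ (Fin d) →L[ℝ]
      EuclideanSpace ℝ (Fin d) →L[ℝ] ℝ)) ∞ (fun y => Bundle.TotalSpace.mk'
      (EuclideanSpace ℝ (Fin d) →L[ℝ]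
      EuclideanSpace ℝ (Fin d) →L[ℝ] ℝ) (E := fun x : M => TangentSpace (𝓡 d) x →L[ℝ]
      TangentSpace (𝓡 d) x →L[ℝ] ℝ) (e.symm y) (T (e.symm y))) y :=
    (hT (e.symm y)).comp y (hes.contMDiffAt (e.open_target.mem_nhds hy))
  have h4 : ContMDiffAt (𝓡 d) ((𝓡 d).prod 𝓘(ℝ)) ∞
      (fun m ↦ Bundle.TotalSpace.mk' ℝ (E := Bundle.Trivial M ℝ) (e.symm m)
        (T (e.symm m) (mfderiv (𝓡 d) (𝓡 d) e.symm m u) (mfderiv (𝓡 d) (𝓡 d) e.symm m v))) y := by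
    apply ContMDiffAt.clm_bundle_apply₂ (F₁ := EuclideanSpace ℝ (Fin d))
      (F₂ := EuclideanSpace ℝ (Fin d))
    · exact h3
    · exact h1
    · exact h2
  simp only [Bundle.contMDiffAt_totalSpace] at h4
  exact h4.2.contDiffAt.contDiffWithinAt

/-- A field of bilinear forms whose expression in some chart around `x` is smooth is a smooth
section at `x`. -/
theorem contMDiffAt_of_contDiffOn_inChart [IsManifold (𝓡 d) ∞ M]
    (he : e ∈ IsManifold.maximalAtlas (𝓡 d) ∞ M) {T : BilinField d M} {x : M} (hx : x ∈ e.source)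
    {V : Set (EuclideanSpace ℝ (Fin d))} (hV : IsOpen V) (hxV : e x ∈ V)
    (hT : ContDiffOn ℝ ∞ (inChart e T) V) :
    ContMDiffAt (𝓡 d) ((𝓡 d).prod 𝓘(ℝ, EuclideanSpace ℝ (Fin d) →L[ℝ]
      EuclideanSpace ℝ (Fin d) →L[ℝ] ℝ)) ∞
      (fun b => Bundle.TotalSpace.mk' (EuclideanSpace ℝ (Fin d) →L[ℝ]
      EuclideanSpace ℝ (Fin d) →L[ℝ] ℝ) (E := fun x : M => TangentSpace (𝓡 d) x →L[ℝ]
      TangentSpace (𝓡 d) x →L[ℝ] ℝ) b (T b)) x := by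
  set e₀ := chartAt (EuclideanSpace ℝ (Fin d)) x with he₀_def
  have he₀ : e₀ ∈ IsManifold.maximalAtlas (𝓡 d) ∞ M := IsManifold.chart_mem_maximalAtlas x
  have hx₀ : x ∈ e₀.source := mem_chart_source _ x
  have h1 := contDiffOn_inChart_pullback he₀ he 1 hV hT
  rw [pullback_one] at h1
  have hU := (contDiffOn_chartMap he₀ he 1).continuousOn.isOpen_inter_preimage
    (isOpen_chartDomain 1) hV
  have hmem : e₀ x ∈ chartDomain e₀ e 1 ∩ chartMap e₀ e 1 ⁻¹' V := by
    refine ⟨mem_chartDomain hx₀ hx, ?_⟩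
    rw [Set.mem_preimage, chartMap_apply hx₀]
    exact hxV
  have h2 : ContMDiffAt (𝓡 d) 𝓘(ℝ, EuclideanSpace ℝ (Fin d) →L[ℝ]
      EuclideanSpace ℝ (Fin d) →L[ℝ] ℝ) ∞ (fun b => inChart e₀ T (e₀ b)) x :=
    (h1.contDiffAt (hU.mem_nhds hmem)).contMDiffAt.comp x
      ((contMDiffOn_of_mem_maximalAtlas he₀).contMDiffAt (e₀.open_source.mem_nhds hx₀))
  rw [contMDiffAt_hom_bundle]
  refine ⟨contMDiffAt_id, h2.congr_of_eventuallyEq ?_⟩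
  refine Filter.eventuallyEq_of_mem (e₀.open_source.mem_nhds hx₀) fun b hb => ?_
  ext u v
  have hbase : b ∈ (trivializationAt (EuclideanSpace ℝ (Fin d))
    (fun x : M => TangentSpace (𝓡 d) x) x).baseSet := hb
  have hs : ∀ u, (trivializationAt (EuclideanSpace ℝ (Fin d))
      (fun x : M => TangentSpace (𝓡 d) x) x).symm b u = modelDeriv d e₀.symm (e₀ b) u := by
    intro u
    have h5 := congrArg (fun L => L u) (TangentBundle.symmL_trivializationAt (I := 𝓡 d) hb)
    refine (Bundle.Trivialization.symmL_apply (R := ℝ) _ hbase u).symm.trans (h5.trans ?_)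
    rw [ModelWithCorners.range_eq_univ, mfderivWithin_univ]
    rfl
  refine (inCoordinates_apply_eq₂ hbase hbase (Set.mem_univ _)).trans ?_
  rw [inChart_eq, bilinPull_apply, e₀.left_inv hb, ← hs, ← hs]
  have htriv : ∀ t : ℝ, (trivializationAt ℝ (Bundle.Trivial M ℝ) x).linearMapAt ℝ b t = t := by
    intro t
    simp
  exact htriv _

end Charts

/-! ### Series of fields of bilinear forms -/

section Series

variable {d : ℕ} {M : Type*} [TopologicalSpace M] [ChartedSpace (EuclideanSpace ℝ (Fin d)) M]

theorem inChart_smul (e : OpenPartialHomeomorph M (EuclideanSpace ℝ (Fin d))) (c : ℝ)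
    (T : BilinField d M) : inChart e (c • T) = c • inChart e T := by
  funext y
  exact (bilinPull (modelDeriv d e.symm y)).map_smul c (T.form _)

theorem BilinField.IsSmooth.const_smul {T : BilinField d M} (hT : T.IsSmooth) (c : ℝ) :
    BilinField.IsSmooth (c • T) := fun e he => by
  rw [inChart_smul]
  exact (hT e he).const_smul c

variable (A : ChartCover d M)

/-- The derivatives of a smooth field of bilinear forms in the charts of the covering are
bounded. -/
theorem ChartCover.exists_bound_of_isSmooth {T : BilinField d M} (hT : T.IsSmooth) (r : ℕ) :
    ∃ C : ℝ, 1 ≤ C ∧ ∀ i, ∀ x ∈ A.K i, ∀ k ≤ r,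
      ‖iteratedFDeriv ℝ k (inChart (A.e i) T) (A.e i x)‖ ≤ C := by
  have h : ∀ i, ∃ R : ℝ, 1 ≤ R ∧ ∀ k ≤ r, ∀ y ∈ A.e i '' A.K i,
      ‖iteratedFDeriv ℝ k (inChart (A.e i) T) y‖ ≤ R := fun i =>
    (hT _ (A.mem_maximalAtlas i)).exists_bound_iteratedFDeriv (A.e i).open_target
      ((A.isCompact i).image_of_continuousOn ((A.e i).continuousOn.mono (A.subset_source i)))
      (Set.image_subset_iff.2 fun x hx => (A.e i).map_source (A.subset_source i hx)) r
  choose R hR1 hR using h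
  refine ⟨1 + ∑ i, R i, ?_, fun i x hx k hk => (hR i k hk _ ⟨x, hx, rfl⟩).trans ?_⟩
  · linarith [Finset.sum_nonneg fun i (_ : i ∈ Finset.univ) => zero_le_one.trans (hR1 i)]
  · linarith [Finset.single_le_sum (f := R) (fun i _ => zero_le_one.trans (hR1 i))
      (Finset.mem_univ i)]

/-- The transition maps from a chart `e` to the charts of the covering have bounded derivatives on
a compact subset of the domain of `e`. -/
theorem ChartCover.exists_bound_transition [IsManifold (𝓡 d) ∞ M] [T2Space M]
    {e : OpenPartialHomeomorph M (EuclideanSpace ℝ (Fin d))}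
    (he : e ∈ IsManifold.maximalAtlas (𝓡 d) ∞ M) {L : Set M} (hL : IsCompact L) (hLe : L ⊆ e.source)
    (r : ℕ) : ∃ D : ℝ, 1 ≤ D ∧ ∀ j, ∀ x ∈ L, x ∈ A.K j → ∀ k ≤ r,
      ‖iteratedFDeriv ℝ k (chartMap e (A.e j) 1) (e x)‖ ≤ D := by
  have h : ∀ j, ∃ R : ℝ, 1 ≤ R ∧ ∀ k ≤ r, ∀ y ∈ e '' (L ∩ A.K j),
      ‖iteratedFDeriv ℝ k (chartMap e (A.e j) 1) y‖ ≤ R := fun j =>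
    (contDiffOn_chartMap he (A.mem_maximalAtlas j) 1).exists_bound_iteratedFDeriv
      (isOpen_chartDomain 1)
      ((hL.inter (A.isCompact j)).image_of_continuousOn
        (e.continuousOn.mono (Set.inter_subset_left.trans hLe)))
      (Set.image_subset_iff.2 fun x hx => mem_chartDomain (hLe hx.1) (A.subset_source j hx.2)) r
  choose R hR1 hR using h
  refine ⟨1 + ∑ i, R i, ?_, fun j x hx hxj k hk => (hR j k hk _ ⟨x, ⟨hx, hxj⟩, rfl⟩).trans ?_⟩
  · linarith [Finset.sum_nonneg fun i (_ : i ∈ Finset.univ) => zero_le_one.trans (hR1 i)]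
  · linarith [Finset.single_le_sum (f := R) (fun i _ => zero_le_one.trans (hR1 i))
      (Finset.mem_univ j)]

/-- Bounds for the derivatives of a field in the charts of the covering give bounds in any other
chart, locally uniformly. -/
theorem ChartCover.exists_bound_chart_change [IsManifold (𝓡 d) ∞ M] [T2Space M]
    {e : OpenPartialHomeomorph M (EuclideanSpace ℝ (Fin d))}
    (he : e ∈ IsManifold.maximalAtlas (𝓡 d) ∞ M) {L : Set M} (hL : IsCompact L) (hLe : L ⊆ e.source)
    (r : ℕ) : ∃ C : ℝ, ∀ (T : BilinField d M) (c : ℝ), T.IsSmooth →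
      (∀ i, ∀ x ∈ A.K i, ∀ k ≤ r, ‖iteratedFDeriv ℝ k (inChart (A.e i) T) (A.e i x)‖ ≤ c) →
      ∀ x ∈ L, ∀ k ≤ r, ‖iteratedFDeriv ℝ k (inChart e T) (e x)‖ ≤ C * c := by
  obtain ⟨D, hD1, hD⟩ := A.exists_bound_transition he hL hLe (r + 1)
  refine ⟨4 ^ r * r.factorial * D ^ (r + 2), fun T c hT hc x hx k hk => ?_⟩
  obtain ⟨j, hj⟩ := A.cover x
  have hmem : e x ∈ chartDomain e (A.e j) 1 := mem_chartDomain (hLe hx) (A.subset_source j hj)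
  have h1 := inChart_pullback_eqOn he (A.mem_maximalAtlas j) 1 T
  rw [pullback_one] at h1
  have h2 : inChart e T =ᶠ[𝓝 (e x)] formPullback (chartMap e (A.e j) 1) (inChart (A.e j) T) :=
    Filter.eventuallyEq_of_mem ((isOpen_chartDomain 1).mem_nhds hmem) h1
  rw [(h2.iteratedFDeriv ℝ k).eq_of_nhds]
  refine (norm_iteratedFDeriv_formPullback_le (isOpen_chartDomain 1) (A.e j).open_target
    (contDiffOn_chartMap he (A.mem_maximalAtlas j) 1) (hT _ (A.mem_maximalAtlas j))
    (mapsTo_chartMap 1) hmem hD1 (hD j x hx hj) (C := c) ?_ hk).trans (le_of_eq (by ring))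
  intro k hk
  rw [chartMap_apply (hLe hx)]
  exact hc j x hj k hk

/-- The pointwise sum of a family of fields of bilinear forms; it is zero at points where the family is
not summable. -/
def sumField {ι : Type*} (W : ι → BilinField d M) : BilinField d M :=
  fun x => ∑' a, (W a).form x

variable {ι : Type*} {W : ι → BilinField d M} {u : ℕ → ι → ℝ}

theorem ChartCover.summable_form [IsManifold (𝓡 d) ∞ M] (hu : ∀ r, Summable (u r))
    (hWu : ∀ r a i, ∀ x ∈ A.K i, ∀ k ≤ r,
      ‖iteratedFDeriv ℝ k (inChart (A.e i) (W a)) (A.e i x)‖ ≤ u r a) (x : M) :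
    Summable fun a => (W a).form x := by
  obtain ⟨i, hi⟩ := A.cover x
  have h1 : Summable fun a => inChart (A.e i) (W a) (A.e i x) := by
    refine Summable.of_norm_bounded (hu 0) fun a => ?_
    have := hWu 0 a i x hi 0 le_rfl
    rwa [norm_iteratedFDeriv_zero] at this
  refine (h1.map (bilinPull (modelDeriv d (A.e i) x))
    (bilinPull (modelDeriv d (A.e i) x)).continuous).congr fun a => ?_
  exact bilinPull_modelDeriv_inChart (A.mem_maximalAtlas i) (W a) (A.subset_source i hi)

theorem ChartCover.inChart_sumField [IsManifold (𝓡 d) ∞ M] (hu : ∀ r, Summable (u r))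
    (hWu : ∀ r a i, ∀ x ∈ A.K i, ∀ k ≤ r,
      ‖iteratedFDeriv ℝ k (inChart (A.e i) (W a)) (A.e i x)‖ ≤ u r a)
    (e : OpenPartialHomeomorph M (EuclideanSpace ℝ (Fin d))) :
    inChart e (sumField W) = fun y => ∑' a, inChart e (W a) y := by
  funext y
  exact (bilinPull (modelDeriv d e.symm y)).map_tsum (A.summable_form hu hWu (e.symm y))

/-- A series of smooth fields with summable bounds on all derivatives in the charts of the covering
satisfies the hypotheses of termwise differentiation near every point of every chart. -/
theorem ChartCover.exists_ball_bound [IsManifold (𝓡 d) ∞ M] [T2Space M] (hu : ∀ r, Summable (u r))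
    (hW : ∀ a, (W a).IsSmooth)
    (hWu : ∀ r a i, ∀ x ∈ A.K i, ∀ k ≤ r,
      ‖iteratedFDeriv ℝ k (inChart (A.e i) (W a)) (A.e i x)‖ ≤ u r a)
    {e : OpenPartialHomeomorph M (EuclideanSpace ℝ (Fin d))}
    (he : e ∈ IsManifold.maximalAtlas (𝓡 d) ∞ M) {y : EuclideanSpace ℝ (Fin d)}
    (hy : y ∈ e.target) :
    ∃ δ > 0, Metric.ball y δ ⊆ e.target ∧ ∃ v : ℕ → ι → ℝ, (∀ k, Summable (v k)) ∧
      ∀ k a, ∀ z ∈ Metric.ball y δ, ‖iteratedFDeriv ℝ k (inChart e (W a)) z‖ ≤ v k a := by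
  obtain ⟨δ, hδ, hball⟩ := Metric.nhds_basis_closedBall.mem_iff.1 (e.open_target.mem_nhds hy)
  have hL : IsCompact (e.symm '' Metric.closedBall y δ) :=
    (isCompact_closedBall y δ).image_of_continuousOn (e.symm.continuousOn.mono hball)
  have hLe : e.symm '' Metric.closedBall y δ ⊆ e.source :=
    Set.image_subset_iff.2 fun z hz => e.map_target (hball hz)
  choose C hC using A.exists_bound_chart_change he hL hLe
  refine ⟨δ, hδ, Metric.ball_subset_closedBall.trans hball, fun k a => C k * u k a,
    fun k => (hu k).mul_left _, fun k a z hz => ?_⟩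
  have hz' := Metric.ball_subset_closedBall hz
  have := hC k (W a) (u k a) (hW a) (hWu k a) (e.symm z) ⟨z, hz', rfl⟩ k le_rfl
  rwa [e.right_inv (hball hz')] at this

theorem ChartCover.isSmooth_sumField [IsManifold (𝓡 d) ∞ M] [T2Space M] (hu : ∀ r, Summable (u r))
    (hW : ∀ a, (W a).IsSmooth)
    (hWu : ∀ r a i, ∀ x ∈ A.K i, ∀ k ≤ r,
      ‖iteratedFDeriv ℝ k (inChart (A.e i) (W a)) (A.e i x)‖ ≤ u r a) :
    (sumField W).IsSmooth := by
  intro e he y hy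
  obtain ⟨δ, hδ, hball, v, hv, hb⟩ := A.exists_ball_bound hu hW hWu he hy
  rw [A.inChart_sumField hu hWu]
  exact ((contDiffOn_tsum_of_isPreconnected Metric.isOpen_ball
    (convex_ball y δ).isPreconnected (fun a => (hW a e he).mono hball) hv hb).contDiffAt
    (Metric.ball_mem_nhds y hδ)).contDiffWithinAt

/-- The `C^r` norm of the sum of a series of fields is at most the sum of bounds for the terms. -/
theorem ChartCover.tensorNorm_sumField_le [IsManifold (𝓡 d) ∞ M] [T2Space M] (hu : ∀ r, Summable (u r))
    (hW : ∀ a, (W a).IsSmooth)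
    (hWu : ∀ r a i, ∀ x ∈ A.K i, ∀ k ≤ r,
      ‖iteratedFDeriv ℝ k (inChart (A.e i) (W a)) (A.e i x)‖ ≤ u r a) (r : ℕ) :
    A.tensorNorm r (sumField W) ≤ ENNReal.ofReal (∑' a, u r a) := by
  refine iSup_le fun i => iSup_le fun x => iSup_le fun hx => iSup_le fun k => iSup_le fun hk => ?_
  have hy := (A.e i).map_source (A.subset_source i hx)
  obtain ⟨δ, hδ, hball, v, hv, hb⟩ := A.exists_ball_bound hu hW hWu (A.mem_maximalAtlas i) hy
  rw [A.inChart_sumField hu hWu, iteratedFDeriv_tsum_of_isPreconnected Metric.isOpen_ball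
    (convex_ball _ δ).isPreconnected (fun a => (hW a _ (A.mem_maximalAtlas i)).mono hball) hv hb k
    (Metric.mem_ball_self hδ), ← ofReal_norm]
  exact ENNReal.ofReal_le_ofReal
    (tsum_of_norm_bounded (hu r).hasSum fun a => hWu r a i x hx k hk)

/-! ### Riemannian metrics from smooth positive definite forms -/

theorem SmoothMetric.isSmooth [IsManifold (𝓡 d) ∞ M] (m : SmoothMetric d M) :
    BilinField.IsSmooth m.inner :=
  isSmooth_of_contMDiff m.contMDiff

/-- The unit ball of a positive definite form is bounded, since the tangent space is
finite-dimensional. -/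
theorem isVonNBounded_of_pos (T : BilinField d M) (x : M)
    (hpos : ∀ v : TangentSpace (𝓡 d) x, v ≠ 0 → 0 < T x v v) :
    Bornology.IsVonNBounded ℝ {v : TangentSpace (𝓡 d) x | T x v v < 1} := by
  obtain ⟨c, hc, h⟩ := exists_pos_mul_norm_sq_le (T.form x) hpos
  have : Bornology.IsVonNBounded ℝ {v : EuclideanSpace ℝ (Fin d) | T.form x v v < 1} := by
    rw [NormedSpace.isVonNBounded_iff, isBounded_iff_forall_norm_le]
    refine ⟨1 + c⁻¹, fun v hv => ?_⟩
    have h1 : c * ‖v‖ ^ 2 < 1 := (h v).trans_lt hv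
    have h2 : ‖v‖ ^ 2 < c⁻¹ := by
      rw [← one_div, lt_div_iff₀ hc]
      linarith
    nlinarith [sq_nonneg (‖v‖ - 1)]
  exact this

theorem exists_smoothMetric_inner_eq [IsManifold (𝓡 d) ∞ M] {T : BilinField d M} (hT : T.IsSmooth)
    (hsymm : ∀ x (v w : TangentSpace (𝓡 d) x), T x v w = T x w v)
    (hpos : ∀ x (v : TangentSpace (𝓡 d) x), v ≠ 0 → 0 < T x v v) :
    ∃ m : SmoothMetric d M, m.inner = T :=
  ⟨⟨T, hsymm, hpos, fun x => isVonNBounded_of_pos T x (hpos x), fun x =>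
    contMDiffAt_of_contDiffOn_inChart (IsManifold.chart_mem_maximalAtlas x)
      (mem_chart_source _ x) (chartAt _ x).open_target (mem_chart_target _ x)
      (hT _ (IsManifold.chart_mem_maximalAtlas x))⟩, rfl⟩

/-- Compact manifolds carry Riemannian metrics: the flat metrics of charts are glued by a partition
of unity. -/
theorem exists_smoothMetric [IsManifold (𝓡 d) ∞ M] [T2Space M] [CompactSpace M] :
    Nonempty (SmoothMetric d M) := by
  obtain ⟨s, hs⟩ := exists_contMDiffSection_forall_mem_convex_of_local (I := 𝓡 d) (n := ⊤)
    (F_fiber := EuclideanSpace ℝ (Fin d) →L[ℝ] EuclideanSpace ℝ (Fin d) →L[ℝ] ℝ)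
    (fun x : M => TangentSpace (𝓡 d) x →L[ℝ] TangentSpace (𝓡 d) x →L[ℝ] ℝ)
    (fun x => {B | (∀ v w : TangentSpace (𝓡 d) x, B v w = B w v) ∧
      ∀ v : TangentSpace (𝓡 d) x, v ≠ 0 → 0 < B v v})
    (fun x => by
      intro B hB B' hB' a b ha hb hab
      refine ⟨fun v w => ?_, fun v hv => ?_⟩
      · change a * B v w + b * B' v w = a * B w v + b * B' w v
        rw [hB.1, hB'.1]
      · change 0 < a * B v v + b * B' v v
        have h1 := hB.2 v hv
        have h2 := hB'.2 v hv
        rcases ha.eq_or_lt with rfl | ha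
        · have : b = 1 := by linarith
          subst this
          linarith
        · have := mul_pos ha h1
          have := mul_nonneg hb h2.le
          linarith)
    (fun x₀ => by
      set e := chartAt (EuclideanSpace ℝ (Fin d)) x₀
      have he : e ∈ IsManifold.maximalAtlas (𝓡 d) ∞ M := IsManifold.chart_mem_maximalAtlas x₀
      let T : BilinField d M := fun x => bilinPull (modelDeriv d e x)
        (innerSL ℝ (E := EuclideanSpace ℝ (Fin d)))
      have hTe : Set.EqOn (inChart e T) (fun _ => innerSL ℝ) e.target := by
        intro y hy
        have h : T.form (e.symm y) = bilinPull (modelDeriv d e (e.symm y)) (innerSL ℝ) := rfl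
        rw [inChart_eq, h, ← bilinPull_comp, modelDeriv_comp_modelDeriv_symm he hy, bilinPull_id]
      refine ⟨e.source, e.open_source.mem_nhds (mem_chart_source _ x₀), T, fun x hx => ?_,
        fun x hx => ⟨fun v w => ?_, fun v hv => ?_⟩⟩
      · exact (contMDiffAt_of_contDiffOn_inChart he hx e.open_target (e.map_source hx)
          (contDiffOn_const.congr hTe)).contMDiffWithinAt
      · exact real_inner_comm (F := EuclideanSpace ℝ (Fin d)) (modelDeriv d e x w)
          (modelDeriv d e x v)
      · refine (real_inner_self_pos (F := EuclideanSpace ℝ (Fin d))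
          (x := modelDeriv d e x v)).2 fun h0 => hv ?_
        have h := congrArg (fun L => L v) (modelDeriv_symm_comp_modelDeriv he hx)
        refine h.symm.trans ?_
        change modelDeriv d e.symm (e x) (modelDeriv d e x v) = 0
        rw [h0, map_zero])
  exact ⟨(exists_smoothMetric_inner_eq (T := s) (isSmooth_of_contMDiff s.contMDiff)
    (fun x => (hs x).1) fun x => (hs x).2).choose⟩

end Series

/-! ### Word length and summation over a group of sub-exponential growth -/

section Words

variable {Γ : Type*} [Group Γ] {S : Set Γ}

theorem wordLength_prod_le {l : List Γ} (hl : IsWord S l) : wordLength S l.prod ≤ l.length :=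
  Nat.sInf_le ⟨l, hl, rfl, rfl⟩

theorem exists_isWord_length_eq_wordLength {g : Γ} (hg : g ∈ Subgroup.closure S) :
    ∃ l : List Γ, IsWord S l ∧ l.length = wordLength S g ∧ l.prod = g := by
  rw [← Subgroup.mem_toSubmonoid, Subgroup.closure_toSubmonoid] at hg
  obtain ⟨l, hl, hlg⟩ := Submonoid.exists_list_of_mem_closure hg
  exact Nat.sInf_mem (s := {n : ℕ | ∃ l : List Γ, IsWord S l ∧ l.length = n ∧ l.prod = g})
    ⟨l.length, l, hl, rfl, hlg⟩

theorem wordLength_one : wordLength S (1 : Γ) = 0 :=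
  Nat.le_zero.1 (wordLength_prod_le (S := S) (l := []) (by simp [IsWord]))

theorem wordLength_mul_le {g s : Γ} (hg : g ∈ Subgroup.closure S) (hs : s ∈ S ∨ s⁻¹ ∈ S) :
    wordLength S (g * s) ≤ wordLength S g + 1 := by
  obtain ⟨l, hl, hlen, rfl⟩ := exists_isWord_length_eq_wordLength hg
  have hw : IsWord S (l ++ [s]) := by
    intro a ha
    rcases List.mem_append.1 ha with h | h
    · exact hl a h
    · rw [List.mem_singleton.1 h]
      exact hs
  have := wordLength_prod_le hw
  simp only [List.prod_append, List.prod_singleton, List.length_append, List.length_singleton] at this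
  omega

theorem finite_setOf_isWord_prod (hS : S.Finite) (n : ℕ) :
    {g : Γ | ∃ l : List Γ, IsWord S l ∧ l.length = n ∧ l.prod = g}.Finite := by
  induction n with
  | zero =>
    refine (Set.finite_singleton (1 : Γ)).subset ?_
    rintro g ⟨l, -, hl, rfl⟩
    simp [List.length_eq_zero_iff.1 hl]
  | succ n ih =>
    refine (Set.Finite.image2 (· * ·) (hS.union hS.inv) ih).subset ?_
    rintro g ⟨l, hw, hl, rfl⟩
    obtain ⟨a, l', rfl⟩ := List.exists_cons_of_length_eq_add_one hl
    refine ⟨a, hw a (by simp), l'.prod, ⟨l', fun b hb => hw b (by simp [hb]), by simpa using hl, rfl⟩,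
      by simp⟩

theorem finite_wordBall (hS : S.Finite) (n : ℕ) : (wordBall (Subgroup.closure S) S n).Finite := by
  refine ((Set.finite_Iic n).biUnion fun k _ => finite_setOf_isWord_prod hS k).subset ?_
  rintro g ⟨hg, hn⟩
  exact Set.mem_biUnion hn (exists_isWord_length_eq_wordLength hg)

/-- In a group of sub-exponential growth the series `∑ e^{-η|g|}` converges for every `η > 0`. -/
theorem summable_exp_neg_mul_wordLength (hS : S.Finite)
    (hgrowth : SubexpGrowth (Subgroup.closure S) S) {η : ℝ} (hη : 0 < η) :
    Summable fun g : Subgroup.closure S => Real.exp (-η * wordLength S (g : Γ)) := by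
  -- Sum over the spheres `|g| = n`, whose cardinality is at most `|B_n| ≤ e^{ηn/2}` for large `n`.
  let len : Subgroup.closure S → ℕ := fun g => wordLength S (g : Γ)
  let emb : ∀ n, {g // len g = n} → wordBall (Subgroup.closure S) S n :=
    fun n g => ⟨g.1.1, g.1.2, g.2.le⟩
  have hemb : ∀ n, Function.Injective (emb n) := fun n g h hgh =>
    Subtype.ext (Subtype.ext (congrArg (fun a => a.1) hgh))
  have hball_fin : ∀ n, Finite (wordBall (Subgroup.closure S) S n) := fun n =>
    (finite_wordBall hS n).to_subtype
  have hfin : ∀ n, Finite {g // len g = n} := fun n => Finite.of_injective (emb n) (hemb n)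
  rw [← (Equiv.sigmaFiberEquiv len).summable_iff]
  refine (summable_sigma_of_nonneg fun _ => (Real.exp_pos _).le).2 ⟨fun n => Summable.of_finite, ?_⟩
  have hterm : ∀ n : ℕ, ∑' g : {g // len g = n}, Real.exp (-η * wordLength S (g.1 : Γ))
      = (Nat.card {g // len g = n} : ℝ) * Real.exp (-η * n) := by
    intro n
    rw [tsum_congr (g := fun _ => Real.exp (-η * n)) fun g => by
        rw [show wordLength S (g.1 : Γ) = n from g.2],
      tsum_const, nsmul_eq_mul]
  have hcard : ∀ n : ℕ, Nat.card {g // len g = n} ≤ (wordBall (Subgroup.closure S) S n).ncard :=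
    fun n => Nat.card_le_card_of_injective (emb n) (hemb n)
  have hgeo : Summable fun n : ℕ => Real.exp (n * (-(η / 2))) :=
    Real.summable_exp_nat_mul_iff.2 (by linarith)
  refine Summable.of_norm_bounded_eventually_nat hgeo ?_
  filter_upwards [hgrowth.eventually (gt_mem_nhds (half_pos hη)), Filter.eventually_gt_atTop 0]
    with n hn hn0
  have hn0' : (0 : ℝ) < n := by exact_mod_cast hn0
  have hpos : 0 < (wordBall (Subgroup.closure S) S n).ncard :=
    (Set.ncard_pos (finite_wordBall hS n)).2 ⟨1, one_mem _, by rw [wordLength_one]; omega⟩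
  have hball : ((wordBall (Subgroup.closure S) S n).ncard : ℝ) ≤ Real.exp (η / 2 * n) := by
    rw [← Real.log_le_iff_le_exp (by exact_mod_cast hpos)]
    rw [div_lt_iff₀ hn0'] at hn
    exact hn.le
  refine (le_of_eq ?_).trans ((mul_le_mul_of_nonneg_right ((Nat.cast_le (α := ℝ)).2 (hcard n))
    (Real.exp_pos (-η * n)).le).trans ((mul_le_mul_of_nonneg_right hball (Real.exp_pos _).le).trans
    (le_of_eq ?_)))
  · rw [← hterm n, Real.norm_of_nonneg (tsum_nonneg fun _ => (Real.exp_pos _).le)]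
    rfl
  · rw [← Real.exp_add]
    congr 1
    ring

end Words

/-! ### Growth of the derivatives of pullbacks -/

section Derivatives

variable {d : ℕ} {M : Type*} [TopologicalSpace M] [ChartedSpace (EuclideanSpace ℝ (Fin d)) M]
  [IsManifold (𝓡 d) ∞ M]

/-- The `C^r` norm of a diffeomorphism, which is defined by its action on jets of functions,
controls the derivatives of its expressions in charts: test it on the coordinate functions, scaled
so that their jets have norm at most one. -/
theorem ChartCover.exists_norm_iteratedFDeriv_chartMap_le [T2Space M] (A : ChartCover d M) (r : ℕ) :
    ∃ R : ℝ, 1 ≤ R ∧ ∀ (g : Diff d M) (B : ℝ), 0 ≤ B → A.crNorm r g ≤ ENNReal.ofReal B →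
      ∀ i j, ∀ x ∈ A.K i, g x ∈ A.K j → ∀ k ≤ r,
        ‖iteratedFDeriv ℝ k (chartMap (A.e i) (A.e j) g) (A.e i x)‖ ≤ R * B := by
  choose D hD1 hD using fun i =>
    A.exists_bound_transition (A.mem_maximalAtlas i) (A.isCompact i) (A.subset_source i) r
  set R : ℝ := 1 + ∑ i, D i with hR
  have hR1 : 1 ≤ R := by
    linarith [Finset.sum_nonneg fun i (_ : i ∈ Finset.univ) => zero_le_one.trans (hD1 i)]
  have hR0 : 0 < R := zero_lt_one.trans_le hR1
  have hDR : ∀ i, D i ≤ R := fun i => by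
    linarith [Finset.single_le_sum (f := D) (fun i _ => zero_le_one.trans (hD1 i))
      (Finset.mem_univ i)]
  refine ⟨R, hR1, fun g B hB hg i j x hx hgx k hk => ?_⟩
  have hcd : ∀ (g : Diff d M) i (x : M), x ∈ A.K i → g x ∈ A.K j →
      ContDiffAt ℝ ∞ (chartMap (A.e i) (A.e j) g) (A.e i x) := fun g i x hx hgx =>
    (contDiffOn_chartMap (A.mem_maximalAtlas i) (A.mem_maximalAtlas j) g).contDiffAt
      ((isOpen_chartDomain g).mem_nhds
        (mem_chartDomain (A.subset_source i hx) (A.subset_source j hgx)))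
  have key : ∀ v : EuclideanSpace ℝ (Fin d), ‖v‖ ≤ 1 →
      ‖(innerSL ℝ v).compContinuousMultilinearMap
        (iteratedFDeriv ℝ k (chartMap (A.e i) (A.e j) g) (A.e i x))‖ ≤ R * B := by
    intro v hv
    set L : EuclideanSpace ℝ (Fin d) →L[ℝ] ℝ := R⁻¹ • innerSL ℝ v with hL
    have hLn : ‖L‖ ≤ R⁻¹ := by
      rw [hL, norm_smul, innerSL_apply_norm, Real.norm_of_nonneg (inv_nonneg.2 hR0.le)]
      exact mul_le_of_le_one_right (inv_nonneg.2 hR0.le) hv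
    let s : M → ℝ := fun z => L (A.e j z)
    have hs : ContMDiffAt (𝓡 d) 𝓘(ℝ, ℝ) ((r : ℕ∞) : WithTop ℕ∞) s (g x) := by
      have h1 := (contMDiffOn_of_mem_maximalAtlas (A.mem_maximalAtlas j)).contMDiffAt
        ((A.e j).open_source.mem_nhds (A.subset_source j hgx))
      exact (L.contMDiff.contMDiffAt.comp (g x) h1).of_le (by exact_mod_cast le_top)
    have hjet : A.jetNorm r s (g x) ≤ 1 := by
      refine iSup_le fun i' => iSup_le fun hi' => iSup_le fun m => iSup_le fun hm => ?_
      rw [← ofReal_norm, ENNReal.ofReal_le_one]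
      have h1 := L.norm_iteratedFDeriv_comp_left (hcd 1 i' (g x) hi' hgx) (n := m)
        (by exact_mod_cast le_top)
      refine h1.trans ((mul_le_mul hLn ((hD i' j (g x) hi' hgx m hm).trans (hDR i'))
        (norm_nonneg _) (inv_nonneg.2 hR0.le)).trans (inv_mul_cancel₀ hR0.ne').le)
    have h1 : ‖iteratedFDeriv ℝ k (fun y => s (g ((A.e i).symm y))) (A.e i x)‖ₑ
        ≤ A.jetNorm r (fun z => s (g z)) x :=
      le_iSup_of_le i (le_iSup_of_le hx (le_iSup_of_le k (le_iSup_of_le hk le_rfl)))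
    have h2 : A.jetNorm r (fun z => s (g z)) x ≤ A.crNorm r g :=
      le_iSup_of_le x (le_iSup_of_le s (le_iSup_of_le hs (le_iSup_of_le hjet le_rfl)))
    have h3 := h1.trans (h2.trans hg)
    rw [← ofReal_norm, ENNReal.ofReal_le_ofReal_iff hB] at h3
    have h4 : iteratedFDeriv ℝ k (fun y => s (g ((A.e i).symm y))) (A.e i x)
        = R⁻¹ • (innerSL ℝ v).compContinuousMultilinearMap
          (iteratedFDeriv ℝ k (chartMap (A.e i) (A.e j) g) (A.e i x)) :=
      L.iteratedFDeriv_comp_left (hcd g i x hx hgx) (i := k) (by exact_mod_cast le_top)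
    rw [h4, norm_smul, Real.norm_of_nonneg (inv_nonneg.2 hR0.le), inv_mul_le_iff₀ hR0] at h3
    exact h3
  refine ContinuousMultilinearMap.opNorm_le_bound (by positivity) fun m => ?_
  set w := iteratedFDeriv ℝ k (chartMap (A.e i) (A.e j) g) (A.e i x) m with hw
  rcases eq_or_ne w 0 with h0 | h0
  · rw [h0, norm_zero]
    positivity
  · have h1 := ((innerSL ℝ (‖w‖⁻¹ • w)).compContinuousMultilinearMap
      (iteratedFDeriv ℝ k (chartMap (A.e i) (A.e j) g) (A.e i x))).le_opNorm m
    have h2 : ((innerSL ℝ (‖w‖⁻¹ • w)).compContinuousMultilinearMap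
      (iteratedFDeriv ℝ k (chartMap (A.e i) (A.e j) g) (A.e i x))) m = ‖w‖ := by
      change inner ℝ (‖w‖⁻¹ • w) w = ‖w‖
      rw [real_inner_smul_left, real_inner_self_eq_norm_sq]
      field_simp
    rw [h2, norm_norm] at h1
    have h3 : ‖‖w‖⁻¹ • w‖ ≤ 1 := by
      rw [norm_smul, norm_inv, norm_norm, inv_mul_cancel₀ (norm_ne_zero_iff.2 h0)]
    exact h1.trans (mul_le_mul_of_nonneg_right (key (‖w‖⁻¹ • w) h3)
      (Finset.prod_nonneg fun _ _ => norm_nonneg _))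

/-- Sub-exponential growth of derivatives makes the `C^r` norms of the pullbacks `g^*T` of a smooth
field grow sub-exponentially in the word length of `g`. -/
theorem ChartCover.exists_bound_pullback [T2Space M] (A : ChartCover d M) {S : Set (Diff d M)}
    (hS : S.Finite) (hderiv : SubexpGrowthOfDerivatives A S) {T : BilinField d M} (hT : T.IsSmooth)
    {δ : ℝ} (hδ : 0 < δ) (r : ℕ) :
    ∃ C : ℝ, ∀ g ∈ Subgroup.closure S, ∀ i, ∀ x ∈ A.K i, ∀ k ≤ r,
      ‖iteratedFDeriv ℝ k (inChart (A.e i) (pullback g T)) (A.e i x)‖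
        ≤ C * Real.exp (δ * wordLength S g) := by
  obtain ⟨R, hR1, hR⟩ := A.exists_norm_iteratedFDeriv_chartMap_le (r + 1)
  obtain ⟨C₀, hC₀, hTC⟩ := A.exists_bound_of_isSmooth hT r
  have hr : (0 : ℝ) < r + 2 := by positivity
  obtain ⟨N, hN⟩ := hderiv (δ / (r + 2)) (by positivity) (r + 1) (Nat.succ_pos r)
  -- The finitely many group elements of length less than `N` are bounded one by one.
  choose c hc1 hc using fun g : Diff d M => A.exists_bound_of_isSmooth (hT.pullback g) r
  have hfin := finite_wordBall hS N
  set C₁ : ℝ := ∑ g ∈ hfin.toFinset, c g with hC₁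
  have hC₁0 : 0 ≤ C₁ := Finset.sum_nonneg fun g _ => zero_le_one.trans (hc1 g)
  set C₂ : ℝ := 4 ^ r * r.factorial * C₀ * R ^ (r + 2) with hC₂
  have hC₂0 : 0 ≤ C₂ := by positivity
  refine ⟨C₁ + C₂, fun g hg i x hx k hk => ?_⟩
  rcases le_total (wordLength S g) N with hlen | hlen
  · have h1 : c g ≤ C₁ := Finset.single_le_sum (f := c) (fun g _ => zero_le_one.trans (hc1 g))
      (hfin.mem_toFinset.2 ⟨hg, hlen⟩)
    have h2 : 1 ≤ Real.exp (δ * wordLength S g) := Real.one_le_exp (by positivity)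
    calc _ ≤ c g := hc g i x hx k hk
      _ ≤ (C₁ + C₂) * 1 := by linarith
      _ ≤ _ := by gcongr
  · obtain ⟨l, hl, hlen', hlg⟩ := exists_isWord_length_eq_wordLength hg
    have h1 := hN _ hlen l hl hlen'
    rw [hlg] at h1
    set B := Real.exp (δ / (r + 2) * wordLength S g) with hB
    have hB1 : 1 ≤ B := Real.one_le_exp (by positivity)
    obtain ⟨j, hj⟩ := A.cover (g x)
    have hmem : A.e i x ∈ chartDomain (A.e i) (A.e j) g :=
      mem_chartDomain (A.subset_source i hx) (A.subset_source j hj)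
    have h2 : inChart (A.e i) (pullback g T) =ᶠ[𝓝 (A.e i x)]
        formPullback (chartMap (A.e i) (A.e j) g) (inChart (A.e j) T) :=
      Filter.eventuallyEq_of_mem ((isOpen_chartDomain g).mem_nhds hmem)
        (inChart_pullback_eqOn (A.mem_maximalAtlas i) (A.mem_maximalAtlas j) g T)
    rw [(h2.iteratedFDeriv ℝ k).eq_of_nhds]
    have h3 := norm_iteratedFDeriv_formPullback_le (isOpen_chartDomain g) (A.e j).open_target
      (contDiffOn_chartMap (A.mem_maximalAtlas i) (A.mem_maximalAtlas j) g)
      (hT _ (A.mem_maximalAtlas j)) (mapsTo_chartMap g) hmem (D := R * B) (C := C₀)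
      (one_le_mul_of_one_le_of_one_le hR1 hB1)
      (fun k hk => hR g B (by positivity) h1 i j x hx hj k hk)
      (fun k hk => by
        rw [chartMap_apply (A.subset_source i hx)]
        exact hTC j _ hj k hk) hk
    have h4 : B ^ (r + 2) = Real.exp (δ * wordLength S g) := by
      rw [hB, ← Real.exp_nat_mul]
      congr 1
      push_cast
      field_simp
    refine h3.trans ?_
    rw [mul_pow, h4, ← mul_assoc, ← hC₂]
    gcongr
    linarith

end Derivatives

/-! ### Averaging a Riemannian metric over the group -/

section Averaging

variable {d : ℕ} {M : Type*} [TopologicalSpace M] [ChartedSpace (EuclideanSpace ℝ (Fin d)) M]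
  [IsManifold (𝓡 d) ∞ M]

/-- The terms `e^{-ε|g|} g^*T` of the averaging series, indexed by the group generated by `S`. -/
def weightedPullback (S : Set (Diff d M)) (ε : ℝ) (T : BilinField d M)
    (g : Subgroup.closure S) : BilinField d M :=
  Real.exp (-ε * wordLength S (g : Diff d M)) • pullback (g : Diff d M) T

variable {A : ChartCover d M} {S : Set (Diff d M)} {ε : ℝ} {T : BilinField d M}

theorem isSmooth_weightedPullback (hT : T.IsSmooth) (g : Subgroup.closure S) :
    (weightedPullback S ε T g).IsSmooth :=
  (hT.pullback _).const_smul _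

omit [IsManifold (𝓡 d) ∞ M] in
theorem norm_iteratedFDeriv_inChart_smul (hT : T.IsSmooth) (c : ℝ) (i : Fin A.card) {x : M}
    (hx : x ∈ A.K i) (k : ℕ) :
    ‖iteratedFDeriv ℝ k (inChart (A.e i) (c • T)) (A.e i x)‖
      = |c| * ‖iteratedFDeriv ℝ k (inChart (A.e i) T) (A.e i x)‖ := by
  have h := (hT _ (A.mem_maximalAtlas i)).contDiffAt
    ((A.e i).open_target.mem_nhds ((A.e i).map_source (A.subset_source i hx)))
  rw [inChart_smul, iteratedFDeriv_const_smul_apply (h.of_le (by exact_mod_cast le_top)),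
    norm_smul, Real.norm_eq_abs]

/-- All `C^r` norms of the terms of the averaging series are summable. -/
theorem exists_summable_bound_weightedPullback [T2Space M] (hS : S.Finite)
    (hgrowth : SubexpGrowth (Subgroup.closure S) S) (hderiv : SubexpGrowthOfDerivatives A S)
    (hε : 0 < ε) (hT : T.IsSmooth) :
    ∃ u : ℕ → Subgroup.closure S → ℝ, (∀ r, Summable (u r)) ∧
      ∀ r g i, ∀ x ∈ A.K i, ∀ k ≤ r,
        ‖iteratedFDeriv ℝ k (inChart (A.e i) (weightedPullback S ε T g)) (A.e i x)‖ ≤ u r g := by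
  choose C hC using A.exists_bound_pullback hS hderiv hT (half_pos hε)
  refine ⟨fun r g => C r * Real.exp (-(ε / 2) * wordLength S (g : Diff d M)), fun r =>
    (summable_exp_neg_mul_wordLength hS hgrowth (half_pos hε)).mul_left _,
    fun r g i x hx k hk => ?_⟩
  rw [weightedPullback, norm_iteratedFDeriv_inChart_smul (hT.pullback _) _ i hx,
    abs_of_pos (Real.exp_pos _)]
  refine (mul_le_mul_of_nonneg_left (hC r g g.2 i x hx k hk) (Real.exp_pos _).le).trans
    (le_of_eq ?_)
  rw [mul_left_comm, ← Real.exp_add]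
  congr 2
  ring

omit [IsManifold (𝓡 d) ∞ M] in
/-- The partial sum of the averaging series over the ball of radius `n` differs from the whole
series by the negative of the tail. -/
theorem averagedForm_sub_sumField
    (hsum : ∀ x, Summable fun g => (weightedPullback S ε T g).form x) (n : ℕ)
    {s : Finset (Subgroup.closure S)} (hs : ∀ g, g ∈ s ↔ wordLength S (g : Diff d M) ≤ n) :
    averagedForm (Subgroup.closure S) S ε T n - sumField (weightedPullback S ε T)
      = sumField fun g : {g // g ∉ s} => (-1 : ℝ) • weightedPullback S ε T g := by
  funext x
  have h1 : (averagedForm (Subgroup.closure S) S ε T n).form x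
      = ∑ g ∈ s, (weightedPullback S ε T g).form x := by
    have himg : wordBall (Subgroup.closure S) S n = Subtype.val '' (s : Set (Subgroup.closure S)) := by
      ext g
      constructor
      · rintro ⟨hg, hn⟩
        exact ⟨⟨g, hg⟩, (hs _).2 hn, rfl⟩
      · rintro ⟨g, hg, rfl⟩
        exact ⟨g.2, (hs _).1 hg⟩
    rw [BilinField.form, averagedForm, himg, finsum_mem_image Subtype.val_injective.injOn,
      finsum_mem_coe_finset]
    rfl
  have h2 := (hsum x).sum_add_tsum_subtype_compl s
  have h3 : ∑' g : {g // g ∉ s}, ((-1 : ℝ) • weightedPullback S ε T g).form x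
      = -∑' g : {g // g ∉ s}, (weightedPullback S ε T g).form x := by
    rw [← tsum_neg]
    exact tsum_congr fun g => neg_one_smul ℝ ((weightedPullback S ε T g).form x)
  change (averagedForm (Subgroup.closure S) S ε T n).form x - ∑' g, (weightedPullback S ε T g).form x
    = ∑' g : {g // g ∉ s}, ((-1 : ℝ) • weightedPullback S ε T g).form x
  rw [h1, h3, ← h2]
  abel

/-- The averaging series converges in every `C^r` norm, along balls. -/
theorem tendsto_tensorNorm_averagedForm_sub [T2Space M] (hS : S.Finite) (hT : T.IsSmooth)
    {u : ℕ → Subgroup.closure S → ℝ} (hu : ∀ r, Summable (u r))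
    (hWu : ∀ r g i, ∀ x ∈ A.K i, ∀ k ≤ r,
      ‖iteratedFDeriv ℝ k (inChart (A.e i) (weightedPullback S ε T g)) (A.e i x)‖ ≤ u r g) (r : ℕ) :
    Filter.Tendsto (fun n : ℕ => A.tensorNorm r
      (averagedForm (Subgroup.closure S) S ε T n - sumField (weightedPullback S ε T)))
      Filter.atTop (𝓝 0) := by
  have hfin : ∀ n, {g : Subgroup.closure S | wordLength S (g : Diff d M) ≤ n}.Finite := fun n =>
    ((finite_wordBall hS n).preimage Subtype.val_injective.injOn).subset fun g hg => ⟨g.2, hg⟩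
  let s : ℕ → Finset (Subgroup.closure S) := fun n => (hfin n).toFinset
  have hs : ∀ n g, g ∈ s n ↔ wordLength S (g : Diff d M) ≤ n := fun n g => (hfin n).mem_toFinset
  have hlim : Filter.Tendsto s Filter.atTop Filter.atTop :=
    Filter.tendsto_atTop_finset_of_monotone
      (fun n n' hn g hg => (hs _ _).2 (((hs _ _).1 hg).trans hn)) fun g => ⟨_, (hs _ _).2 le_rfl⟩
  have htail := ENNReal.tendsto_ofReal ((tendsto_tsum_compl_atTop_zero (u r)).comp hlim)
  rw [ENNReal.ofReal_zero] at htail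
  refine tendsto_of_tendsto_of_tendsto_of_le_of_le tendsto_const_nhds htail
    (fun _ => zero_le) fun n => ?_
  rw [averagedForm_sub_sumField (A.summable_form hu hWu) n (hs n)]
  refine A.tensorNorm_sumField_le (u := fun r (g : {g // g ∉ s n}) => u r g)
    (fun r => (hu r).subtype _) (fun g => (isSmooth_weightedPullback hT _).const_smul _)
    (fun r g i x hx k hk => ?_) r
  rw [norm_iteratedFDeriv_inChart_smul (isSmooth_weightedPullback hT _) _ i hx, abs_neg, abs_one,
    one_mul]
  exact hWu r g i x hx k hk

theorem HasSum.bilin_apply {ι E : Type*} [NormedAddCommGroup E] [NormedSpace ℝ E]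
    {f : ι → E →L[ℝ] E →L[ℝ] ℝ} {a : E →L[ℝ] E →L[ℝ] ℝ} (hf : HasSum f a) (v w : E) :
    HasSum (fun i => f i v w) (a v w) :=
  (ContinuousLinearMap.apply ℝ ℝ w).hasSum ((ContinuousLinearMap.apply ℝ (E →L[ℝ] ℝ) v).hasSum hf)

omit [IsManifold (𝓡 d) ∞ M] in
theorem hasSum_sumField_apply
    (hsum : ∀ x, Summable fun g => (weightedPullback S ε T g).form x) (x : M)
    (v w : EuclideanSpace ℝ (Fin d)) :
    HasSum (fun g : Subgroup.closure S => Real.exp (-ε * wordLength S (g : Diff d M)) *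
      (pullback (g : Diff d M) T).form x v w) ((sumField (weightedPullback S ε T)).form x v w) :=
  (hsum x).hasSum.bilin_apply v w

omit [IsManifold (𝓡 d) ∞ M] in
/-- A generator `s` changes the averaged form by at most the factor `e^ε` either way: it permutes
the terms of the series, and the word lengths of `g` and `g * s` differ by at most one. -/
theorem sumField_quasi_invariant (hε : 0 < ε) (hpos : ∀ x v, 0 ≤ T.form x v v)
    (hsum : ∀ x, Summable fun g => (weightedPullback S ε T g).form x) {s : Diff d M} (hs : s ∈ S)
    (x : M) (v : EuclideanSpace ℝ (Fin d)) :
    Real.exp (-ε) * (sumField (weightedPullback S ε T)).form x v v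
      ≤ (sumField (weightedPullback S ε T)).form (s x) (modelDeriv d s x v) (modelDeriv d s x v) ∧
    (sumField (weightedPullback S ε T)).form (s x) (modelDeriv d s x v) (modelDeriv d s x v)
      ≤ Real.exp ε * (sumField (weightedPullback S ε T)).form x v v := by
  let s' : Subgroup.closure S := ⟨s, Subgroup.subset_closure hs⟩
  have hterm : ∀ g : Diff d M, (pullback g T).form (s x) (modelDeriv d s x v) (modelDeriv d s x v)
      = (pullback (g * s) T).form x v v := fun g => by
    rw [pullback_mul_form]
    rfl
  have h1 := hasSum_sumField_apply hsum (s x) (modelDeriv d s x v) (modelDeriv d s x v)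
  simp only [hterm] at h1
  have h2 := (Equiv.mulRight s').hasSum_iff.2 (hasSum_sumField_apply hsum x v v)
  have hnn : ∀ g : Diff d M, 0 ≤ (pullback g T).form x v v := fun g => hpos _ _
  constructor
  · refine hasSum_le (fun g => ?_) (h2.mul_left (Real.exp (-ε))) h1
    change Real.exp (-ε) * (Real.exp (-ε * wordLength S ((g : Diff d M) * s)) *
      (pullback ((g : Diff d M) * s) T).form x v v) ≤ _
    rw [← mul_assoc, ← Real.exp_add]
    refine mul_le_mul_of_nonneg_right (Real.exp_le_exp.2 ?_) (hnn _)
    have h3 := wordLength_mul_le (S := S) (g := (g : Diff d M) * s) (s := s⁻¹)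
      (g * s').2 (Or.inr (by rwa [inv_inv]))
    rw [mul_inv_cancel_right] at h3
    have h4 : (wordLength S (g : Diff d M) : ℝ) ≤ wordLength S ((g : Diff d M) * s) + 1 := by
      exact_mod_cast h3
    nlinarith
  · refine hasSum_le (fun g => ?_) h1 (h2.mul_left (Real.exp ε))
    change _ ≤ Real.exp ε * (Real.exp (-ε * wordLength S ((g : Diff d M) * s)) *
      (pullback ((g : Diff d M) * s) T).form x v v)
    rw [← mul_assoc, ← Real.exp_add]
    refine mul_le_mul_of_nonneg_right (Real.exp_le_exp.2 ?_) (hnn _)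
    have h3 := wordLength_mul_le (S := S) g.2 (Or.inl hs)
    have h4 : (wordLength S ((g : Diff d M) * s) : ℝ) ≤ wordLength S (g : Diff d M) + 1 := by
      exact_mod_cast h3
    nlinarith

/-- A bound by `e^ε` for squared lengths gives the bound `e^{ε/2}`, and so `e^ε`, for lengths. -/
theorem bilipschitzOnTangent_of_quasi_invariant {m : SmoothMetric d M} {s : Diff d M} (hε : 0 < ε)
    (h : ∀ (x : M) (v : TangentSpace (𝓡 d) x),
      Real.exp (-ε) * m.inner x v v
        ≤ m.inner (s x) (mfderiv (𝓡 d) (𝓡 d) s x v) (mfderiv (𝓡 d) (𝓡 d) s x v) ∧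
      m.inner (s x) (mfderiv (𝓡 d) (𝓡 d) s x v) (mfderiv (𝓡 d) (𝓡 d) s x v)
        ≤ Real.exp ε * m.inner x v v) :
    BilipschitzOnTangent m ε s := by
  intro x v
  have hq : 0 ≤ m.inner x v v := by
    rcases eq_or_ne v 0 with rfl | hv
    · simp
    · exact (m.pos x v hv).le
  have hsq : ∀ a : ℝ, Real.exp a * tangentNorm m x v
      = Real.sqrt (Real.exp a * (Real.exp a * m.inner x v v)) := by
    intro a
    rw [← mul_assoc, Real.sqrt_mul (by positivity), Real.sqrt_mul_self (Real.exp_pos a).le]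
    rfl
  rw [hsq, hsq]
  constructor
  · refine Real.sqrt_le_sqrt (le_trans ?_ (h x v).1)
    exact mul_le_of_le_one_left (by positivity) (Real.exp_le_one_iff.2 (by linarith))
  · refine Real.sqrt_le_sqrt ((h x v).2.trans ?_)
    exact le_mul_of_one_le_left (by positivity) (Real.one_le_exp hε.le)

/-- The averaging series converges to a Riemannian metric which the generators distort by at most
the factor `e^ε`. -/
theorem exists_averaged_metric [T2Space M] (A : ChartCover d M) (hS : S.Finite)
    (hgrowth : SubexpGrowth (Subgroup.closure S) S) (hderiv : SubexpGrowthOfDerivatives A S)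
    (hε : 0 < ε) (m : SmoothMetric d M) :
    ∃ mε : SmoothMetric d M,
      (∀ r : ℕ, Filter.Tendsto (fun n : ℕ => A.tensorNorm r
        (averagedForm (Subgroup.closure S) S ε m.inner n - mε.inner)) Filter.atTop (𝓝 0)) ∧
      ∀ s ∈ S, BilipschitzOnTangent mε ε s := by
  have hm := SmoothMetric.isSmooth m
  obtain ⟨u, hu, hWu⟩ := exists_summable_bound_weightedPullback hS hgrowth hderiv hε hm
  have hsum := A.summable_form hu hWu
  have hmnn : ∀ x v, 0 ≤ BilinField.form m.inner x v v := by
    intro x v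
    rcases eq_or_ne v 0 with rfl | hv
    · simp
    · exact (m.pos x v hv).le
  obtain ⟨mε, hmε⟩ := exists_smoothMetric_inner_eq
    (A.isSmooth_sumField hu (isSmooth_weightedPullback hm) hWu)
    (fun x v w => by
      have h1 := hasSum_sumField_apply hsum x v w
      have h2 : ∀ g : Diff d M, (pullback g m.inner).form x v w = (pullback g m.inner).form x w v :=
        fun g => m.symm _ _ _
      simp only [h2] at h1
      exact h1.unique (hasSum_sumField_apply hsum x w v))
    (fun x v hv => by
      refine (lt_of_lt_of_le (m.pos x v hv) ?_ :
        0 < (sumField (weightedPullback S ε m.inner)).form x v v)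
      refine le_trans (le_of_eq ?_) (le_hasSum (hasSum_sumField_apply hsum x v v) 1
        fun g _ => mul_nonneg (Real.exp_pos _).le (hmnn _ _))
      rw [Subgroup.coe_one, wordLength_one, pullback_one, Nat.cast_zero, mul_zero, Real.exp_zero,
        one_mul]
      rfl)
  refine ⟨mε, fun r => ?_, fun s hs => bilipschitzOnTangent_of_quasi_invariant hε fun x v => ?_⟩
  · rw [hmε]
    exact tendsto_tensorNorm_averagedForm_sub hS hm hu hWu r
  · rw [hmε]
    exact sumField_quasi_invariant hε hmnn hsum hs x v

end Averaging

end

theorem mainTheorem6 {d : ℕ} {M : Type*} [TopologicalSpace M]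
    [ChartedSpace (EuclideanSpace ℝ (Fin d)) M] [IsManifold (𝓡 d) ∞ M]
    [CompactSpace M] [T2Space M] (A : ChartCover d M)
    (G : Subgroup (Diff d M)) (S : Set (Diff d M)) (hS : S.Finite)
    (hG : Subgroup.closure S = G) (hgrowth : SubexpGrowth G S)
    (hderiv : SubexpGrowthOfDerivatives A S) (ε : ℝ) (hε : 0 < ε) :
    (∃ mε : SmoothMetric d M, ∀ s ∈ S, BilipschitzOnTangent mε ε s) ∧
    ∀ m : SmoothMetric d M, ∃ mε : SmoothMetric d M,
      (∀ r : ℕ, Filter.Tendsto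
        (fun n : ℕ => A.tensorNorm r (averagedForm G S ε m.inner n - mε.inner))
        Filter.atTop (𝓝 0)) ∧
      ∀ s ∈ S, BilipschitzOnTangent mε ε s := by
  subst hG
  have key := exists_averaged_metric A hS hgrowth hderiv hε
  obtain ⟨m₀⟩ := exists_smoothMetric (d := d) (M := M)
  obtain ⟨mε, -, hmε⟩ := key m₀
  exact ⟨⟨mε, hmε⟩, key⟩
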